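/- For a non-empty compact convex set (convex body) $K\subset\mathbb R^2$ let $h_K(u)=\sup_{x\in K}\langle x,u\rangle$ be its support function and $V_2(K)$ its area. For convex bodies $K,L$ containing the origin $o$ and $1\le p<\infty$, the $p$-sum $K+_pL$ is the convex body with support function $(h_K^p+h_L^p)^{1/p}$; $K+_\infty L$ is the convex body with support function $\max\{h_K,h_L\}$. For every $p\in[1,\infty]$ there is a smallest constant $c_{2,p}$ such that $$V_2\big(K+_p(-K)\big)\le c_{2,p}\,V_2(K)\qquad\text{for all convex bodies }K\subset\mathbb R^2\text{ with } o\in K.$$ If $T$ is a (non-degenerate) triangle with one vertex at the origin, then equality holds for $K=T$; moreover $T$ maximizes $F_p(K)=V_2(K+_p(-K))/V_2(K)$ among all convex bodies $K\subset\mathbb R^2$ that contain the origin and have non-empty interior. For $1<p<\infty$ the constant is given by the convergent integral $$c_{2,p}=2\left(1+(p-1)\int_0^{\pi/2}\frac{\sin^{p-2}t\,\cos^{p-2}t}{(\sin^pt+\cos^pt)^{2(p-1)/p}}\,dt\right).$$ -/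

import Mathlib

open MeasureTheory Set
open scoped ENNReal Pointwise RealInnerProductSpace

/-- The Euclidean plane `ℝ²`. Its `volume` is two-dimensional Lebesgue measure. -/
abbrev Plane : Type := EuclideanSpace ℝ (Fin 2)

/-- The support function `h_K(u) = sup {⟨x, u⟩ | x ∈ K}`. -/
noncomputable def supportFunction {E : Type*} [NormedAddCommGroup E] [InnerProductSpace ℝ E]
    (K : Set E) (u : E) : ℝ :=
  sSup ((fun x : E => ⟪x, u⟫) '' K)

/-- The `p`-sum of two (non-negative) numbers: `(a ^ p + b ^ p) ^ (1 / p)` for finite `p`, and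
`max a b` for `p = ∞`. -/
noncomputable def lpAdd (p : ℝ≥0∞) (a b : ℝ) : ℝ :=
  if p = ∞ then max a b else (a ^ p.toReal + b ^ p.toReal) ^ (1 / p.toReal)

/-- Firey's `p`-sum `K +ₚ L` of two convex bodies containing the origin: the set whose support
function is `u ↦ (h_K(u) ^ p + h_L(u) ^ p) ^ (1 / p)`, written as the intersection of the
half-spaces which that function prescribes. That it is a convex body with this support function
is proved in `convex_pSum`, `isCompact_pSum`, `zero_mem_pSum` and `supportFunction_pSum`. -/
def pSum {E : Type*} [NormedAddCommGroup E] [InnerProductSpace ℝ E]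
    (p : ℝ≥0∞) (K L : Set E) : Set E :=
  {x | ∀ u : E, ⟪x, u⟫ ≤ lpAdd p (supportFunction K u) (supportFunction L u)}

/-- The `p`-difference body `K +ₚ (-K)`. -/
def pDifferenceBody {E : Type*} [NormedAddCommGroup E] [InnerProductSpace ℝ E]
    (p : ℝ≥0∞) (K : Set E) : Set E :=
  pSum p K (-K)

/-- The class of planar convex bodies that contain the origin and have non-empty interior. -/
def bodiesAtOrigin : Set (ConvexBody Plane) :=
  {K | (0 : Plane) ∈ K ∧ (interior (K : Set Plane)).Nonempty}

/-- `T` is a (non-degenerate) triangle one of whose vertices is the origin. -/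
def IsTriangleWithVertexAtOrigin (T : ConvexBody Plane) : Prop :=
  ∃ S : Affine.Triangle ℝ Plane,
    (∃ i, S.points i = 0) ∧ (T : Set Plane) = convexHull ℝ (Set.range S.points)

/-- The functional `F_p(K) = V₂(K +ₚ (-K)) / V₂(K)`. -/
noncomputable def differenceRatio (p : ℝ≥0∞) (K : ConvexBody Plane) : ℝ :=
  volume.real (pDifferenceBody p (K : Set Plane)) / volume.real (K : Set Plane)

section Helpers

variable {E : Type*} [NormedAddCommGroup E] [InnerProductSpace ℝ E]

theorem supportFunction_bddAbove {K : Set E} (hK : IsCompact K) (u : E) :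
    BddAbove ((fun x : E => ⟪x, u⟫) '' K) :=
  (hK.image (by fun_prop)).bddAbove

theorem supportFunction_nonneg {K : Set E} (hK : IsCompact K) (h0 : (0 : E) ∈ K) (u : E) :
    0 ≤ supportFunction K u :=
  le_csSup (supportFunction_bddAbove hK u) ⟨0, h0, by simp⟩

theorem inner_le_supportFunction {K : Set E} (hK : IsCompact K) {x : E} (hx : x ∈ K) (u : E) :
    ⟪x, u⟫ ≤ supportFunction K u :=
  le_csSup (supportFunction_bddAbove hK u) ⟨x, hx, rfl⟩

theorem supportFunction_le {K : Set E} (h0 : K.Nonempty) {u : E} {a : ℝ}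
    (h : ∀ x ∈ K, ⟪x, u⟫ ≤ a) : supportFunction K u ≤ a := by
  refine csSup_le (h0.image _) ?_
  rintro _ ⟨x, hx, rfl⟩
  exact h x hx

theorem supportFunction_add_le {K : Set E} (hK : IsCompact K) (h0 : K.Nonempty) (u v : E) :
    supportFunction K (u + v) ≤ supportFunction K u + supportFunction K v := by
  refine supportFunction_le h0 fun x hx => ?_
  rw [inner_add_right]
  exact add_le_add (inner_le_supportFunction hK hx u) (inner_le_supportFunction hK hx v)

theorem supportFunction_smul (K : Set E) {c : ℝ} (hc : 0 ≤ c) (u : E) :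
    supportFunction K (c • u) = c * supportFunction K u := by
  unfold supportFunction
  rw [← smul_eq_mul, ← Real.sSup_smul_of_nonneg hc, ← Set.image_smul, Set.image_image]
  simp [inner_smul_right]

theorem lpAdd_nonneg (p : ℝ≥0∞) {a b : ℝ} (ha : 0 ≤ a) (hb : 0 ≤ b) : 0 ≤ lpAdd p a b := by
  unfold lpAdd
  split_ifs
  · exact ha.trans (le_max_left _ _)
  · positivity

theorem one_le_toReal {p : ℝ≥0∞} (hp : 1 ≤ p) (h : p ≠ ∞) : 1 ≤ p.toReal := by
  simpa using ENNReal.toReal_mono h hp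

theorem lpAdd_mono {p : ℝ≥0∞} {a b a' b' : ℝ} (ha : 0 ≤ a) (hb : 0 ≤ b)
    (haa : a ≤ a') (hbb : b ≤ b') : lpAdd p a b ≤ lpAdd p a' b' := by
  unfold lpAdd
  split_ifs
  · exact max_le_max haa hbb
  · gcongr

theorem lpAdd_smul {p : ℝ≥0∞} (hp : 1 ≤ p) {a b c : ℝ} (ha : 0 ≤ a) (hb : 0 ≤ b) (hc : 0 ≤ c) :
    lpAdd p (c * a) (c * b) = c * lpAdd p a b := by
  unfold lpAdd
  split_ifs with h
  · exact (mul_max_of_nonneg a b hc).symm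
  · have h1 := one_le_toReal hp h
    rw [Real.mul_rpow hc ha, Real.mul_rpow hc hb, ← mul_add, Real.mul_rpow (by positivity)
      (by positivity), ← Real.rpow_mul hc, mul_one_div_cancel (by positivity), Real.rpow_one]

theorem lpAdd_add_le {p : ℝ≥0∞} (hp : 1 ≤ p) {a b a' b' : ℝ} (ha : 0 ≤ a) (hb : 0 ≤ b)
    (ha' : 0 ≤ a') (hb' : 0 ≤ b') :
    lpAdd p (a + a') (b + b') ≤ lpAdd p a b + lpAdd p a' b' := by
  unfold lpAdd
  split_ifs with h
  · exact max_le (add_le_add (le_max_left _ _) (le_max_left _ _))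
      (add_le_add (le_max_right _ _) (le_max_right _ _))
  · have := Real.Lp_add_le_of_nonneg (Finset.univ : Finset (Fin 2)) (f := ![a, b]) (g := ![a', b'])
      (one_le_toReal hp h) (by intro i _; fin_cases i <;> simpa)
      (by intro i _; fin_cases i <;> simpa)
    simpa [Fin.sum_univ_two] using this

theorem lpAdd_le_add {p : ℝ≥0∞} (hp : 1 ≤ p) {a b : ℝ} (ha : 0 ≤ a) (hb : 0 ≤ b) :
    lpAdd p a b ≤ a + b := by
  have h1 : lpAdd p (a + 0) (0 + b) ≤ lpAdd p a 0 + lpAdd p 0 b :=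
    lpAdd_add_le hp ha le_rfl le_rfl hb
  have h2 : lpAdd p a 0 = a ∧ lpAdd p 0 b = b := by
    unfold lpAdd
    split_ifs with h
    · simp [ha, hb]
    · have h3 : p.toReal ≠ 0 := by linarith [one_le_toReal hp h]
      simp [Real.zero_rpow h3, ← Real.rpow_mul ha, ← Real.rpow_mul hb, h3]
  rw [h2.1, h2.2] at h1
  simpa using h1

theorem convex_pSum (p : ℝ≥0∞) (K L : Set E) : Convex ℝ (pSum p K L) := by
  intro x hx y hy a b ha hb hab u
  rw [inner_add_left, real_inner_smul_left, real_inner_smul_left]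
  have := mul_le_mul_of_nonneg_left (hx u) ha
  have := mul_le_mul_of_nonneg_left (hy u) hb
  calc _ ≤ (a + b) * lpAdd p (supportFunction K u) (supportFunction L u) := by linarith
    _ = _ := by rw [hab, one_mul]

theorem zero_mem_pSum (p : ℝ≥0∞) {K L : Set E} (hK : IsCompact K) (hL : IsCompact L)
    (hK0 : (0 : E) ∈ K) (hL0 : (0 : E) ∈ L) : (0 : E) ∈ pSum p K L := by
  intro u
  rw [inner_zero_left]
  exact lpAdd_nonneg p (supportFunction_nonneg hK hK0 u) (supportFunction_nonneg hL hL0 u)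

theorem isCompact_pSum [FiniteDimensional ℝ E] {p : ℝ≥0∞} (hp : 1 ≤ p) {K L : Set E}
    (hK : IsCompact K) (hL : IsCompact L) (hK0 : (0 : E) ∈ K) (hL0 : (0 : E) ∈ L) :
    IsCompact (pSum p K L) := by
  have := FiniteDimensional.proper_real E
  obtain ⟨R, hR⟩ := hK.isBounded.exists_norm_le
  obtain ⟨S, hS⟩ := hL.isBounded.exists_norm_le
  refine Metric.isCompact_of_isClosed_isBounded ?_ ?_
  · have : pSum p K L = ⋂ u : E, {x | ⟪x, u⟫ ≤ lpAdd p (supportFunction K u)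
        (supportFunction L u)} := by
      ext x; simp [pSum]
    rw [this]
    exact isClosed_iInter fun u => isClosed_le (by fun_prop) continuous_const
  · refine isBounded_iff_forall_norm_le.2 ⟨R + S, fun x hx => ?_⟩
    have h1 := (hx x).trans (lpAdd_le_add hp (supportFunction_nonneg hK hK0 x)
      (supportFunction_nonneg hL hL0 x))
    have h2 : supportFunction K x ≤ R * ‖x‖ := supportFunction_le ⟨0, hK0⟩ fun y hy =>
      (real_inner_le_norm y x).trans (mul_le_mul_of_nonneg_right (hR y hy) (norm_nonneg x))
    have h3 : supportFunction L x ≤ S * ‖x‖ := supportFunction_le ⟨0, hL0⟩ fun y hy =>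
      (real_inner_le_norm y x).trans (mul_le_mul_of_nonneg_right (hS y hy) (norm_nonneg x))
    rw [real_inner_self_eq_norm_mul_norm] at h1
    have h4 : ‖x‖ * ‖x‖ ≤ (R + S) * ‖x‖ := by linarith
    rcases (norm_nonneg x).eq_or_lt with h | h
    · rw [← h]
      have := (norm_nonneg (0 : E)).trans (hR 0 hK0)
      have := (norm_nonneg (0 : E)).trans (hS 0 hL0)
      linarith
    · exact le_of_mul_le_mul_right h4 h

/-- The `p`-sum has the support function by which it is defined. -/
theorem supportFunction_pSum [FiniteDimensional ℝ E] {p : ℝ≥0∞} (hp : 1 ≤ p) {K L : Set E}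
    (hK : IsCompact K) (hL : IsCompact L) (hK0 : (0 : E) ∈ K) (hL0 : (0 : E) ∈ L) (u : E) :
    supportFunction (pSum p K L) u = lpAdd p (supportFunction K u) (supportFunction L u) := by
  set N : E → ℝ := fun v => lpAdd p (supportFunction K v) (supportFunction L v) with hN
  have hk := supportFunction_nonneg hK hK0
  have hl := supportFunction_nonneg hL hL0
  have N0 : ∀ v, 0 ≤ N v := fun v => lpAdd_nonneg p (hk v) (hl v)
  have Nsmul : ∀ c : ℝ, 0 < c → ∀ v, N (c • v) = c * N v := fun c hc v => by
    simp only [hN, supportFunction_smul _ hc.le, lpAdd_smul hp (hk v) (hl v) hc.le]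
  have Nadd : ∀ v w, N (v + w) ≤ N v + N w := fun v w =>
    (lpAdd_mono (hk _) (hl _) (supportFunction_add_le hK ⟨0, hK0⟩ v w)
      (supportFunction_add_le hL ⟨0, hL0⟩ v w)).trans
      (lpAdd_add_le hp (hk v) (hl v) (hk w) (hl w))
  refine le_antisymm (supportFunction_le ⟨0, zero_mem_pSum p hK hL hK0 hL0⟩ fun x hx => hx u) ?_
  suffices h : ∃ x ∈ pSum p K L, ⟪x, u⟫ = N u by
    obtain ⟨x, hx, hxu⟩ := h
    have := inner_le_supportFunction (isCompact_pSum hp hK hL hK0 hL0) hx u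
    rwa [hxu] at this
  by_cases hu : u = 0
  · refine ⟨0, zero_mem_pSum p hK hL hK0 hL0, ?_⟩
    have h := Nsmul 2 (by norm_num) 0
    rw [smul_zero] at h
    rw [inner_zero_left, hu]
    linarith
  · obtain ⟨g, hg1, hg2⟩ := exists_extension_of_le_sublinear
      (LinearPMap.mkSpanSingleton u (N u) hu) N Nsmul Nadd (by
        rintro ⟨x, hx⟩
        obtain ⟨c, rfl⟩ := Submodule.mem_span_singleton.1 hx
        have e : LinearPMap.mkSpanSingleton u (N u) hu ⟨c • u, hx⟩ = c • N u :=
          LinearPMap.mkSpanSingleton'_apply _ _ _ _ _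
        rw [e, smul_eq_mul]
        rcases lt_or_ge 0 c with hc | hc
        · exact (Nsmul c hc u).ge
        · exact (mul_nonpos_of_nonpos_of_nonneg hc (N0 u)).trans (N0 _))
    have inn : ∀ v, ⟪(InnerProductSpace.toDual ℝ E).symm (LinearMap.toContinuousLinearMap g), v⟫
        = g v := fun v => by
      rw [InnerProductSpace.toDual_symm_apply]; rfl
    refine ⟨(InnerProductSpace.toDual ℝ E).symm (LinearMap.toContinuousLinearMap g), ?_, ?_⟩
    · intro v
      rw [inn]
      exact hg2 v
    · rw [inn]
      have h := hg1 ⟨u, Submodule.mem_span_singleton_self u⟩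
      rw [h]
      exact LinearPMap.mkSpanSingleton_apply ℝ _ hu (N u)

end Helpers

/-! The function `lpAdd p` is the support function of a planar set, the dual ball `lpDualBall p` in
the positive quadrant. Hence `K +ₚ (-K)` is the union of the Minkowski combinations `a K - b K` over
all `(a, b)` in the dual ball (`pDifferenceBody_eq_dualBallSum`), which turns the problem into
estimating the area of a union.

The area of `a K - b K` is `(a² + b²) V + a b W`, where `V` is the area of `K` and `W` is twice the
mixed area of `K` and `-K` (`exists_mixed_area`). Since `-K` fits into a translate of `2 K`, `W ≤ 4
V` (`mixed_area_le`). Now cover the dual ball by `n` columns. Because `o ∈ K`, the bodies `a K - b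
K` grow with `a` and `b`, so each column contributes only its outer corner, and two successive
corner bodies overlap at least in the body of the inner corner between them. In the resulting
inclusion–exclusion the squares telescope to `2 V`, and the products form a Riemann sum of the area
`A` of the dual ball (`volume_staircase_le`). In the limit the union has area at most `2 V + A W ≤
(2 + 4 A) V`.

For the triangle `o, v, w` the union contains `T`, `-T`, and in each of the two mixed quadrants of
the basis `v, w` a linear copy of the dual ball, of area `2 A V`. These pieces do not overlap, so
the bound is attained (`volume_dualBallSum_originTriangle_ge`). The constant is therefore `2 + 4 A`;
the integral formula arises by computing `A` with the boundary of the dual ball parametrized by its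
normal angle (`dualIntegrand_integral`). -/

/-! ### The dual ball of the `p`-sum of numbers -/

/-- The unit ball of the norm dual to `lpAdd p`, restricted to the positive quadrant. -/
def lpDualBall (p : ℝ≥0∞) : Set (ℝ × ℝ) :=
  {z | 0 ≤ z.1 ∧ 0 ≤ z.2 ∧ ∀ s t : ℝ, 0 ≤ s → 0 ≤ t → z.1 * s + z.2 * t ≤ lpAdd p s t}

theorem lpAdd_zero_right {p : ℝ≥0∞} (hp : 1 ≤ p) {a : ℝ} (ha : 0 ≤ a) : lpAdd p a 0 = a := by
  unfold lpAdd
  split_ifs with h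
  · simp [ha]
  · have h3 : p.toReal ≠ 0 := by linarith [one_le_toReal hp h]
    simp [Real.zero_rpow h3, ← Real.rpow_mul ha, h3]

theorem lpAdd_comm (p : ℝ≥0∞) (a b : ℝ) : lpAdd p a b = lpAdd p b a := by
  unfold lpAdd
  rw [max_comm, add_comm]

theorem lpDualBall_swap {p : ℝ≥0∞} {a b : ℝ} (h : (a, b) ∈ lpDualBall p) :
    (b, a) ∈ lpDualBall p := by
  obtain ⟨h1, h2, h3⟩ := h
  refine ⟨h2, h1, fun s t hs ht => ?_⟩
  have := h3 t s ht hs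
  rw [lpAdd_comm]
  simp only at this ⊢
  linarith

theorem lpDualBall_mono {p : ℝ≥0∞} {a b a' b' : ℝ} (h : (a, b) ∈ lpDualBall p)
    (ha : 0 ≤ a') (hb : 0 ≤ b') (haa : a' ≤ a) (hbb : b' ≤ b) : (a', b') ∈ lpDualBall p := by
  refine ⟨ha, hb, fun s t hs ht => le_trans ?_ (h.2.2 s t hs ht)⟩
  simp only
  gcongr

theorem lpDualBall_fst_le_one {p : ℝ≥0∞} (hp : 1 ≤ p) {a b : ℝ} (h : (a, b) ∈ lpDualBall p) :
    a ≤ 1 := by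
  have := h.2.2 1 0 zero_le_one le_rfl
  rw [lpAdd_zero_right hp zero_le_one] at this
  simpa using this

theorem lpDualBall_snd_le_one {p : ℝ≥0∞} (hp : 1 ≤ p) {a b : ℝ} (h : (a, b) ∈ lpDualBall p) :
    b ≤ 1 :=
  lpDualBall_fst_le_one hp (lpDualBall_swap h)

theorem one_zero_mem_lpDualBall {p : ℝ≥0∞} (hp : 1 ≤ p) : ((1 : ℝ), (0 : ℝ)) ∈ lpDualBall p := by
  refine ⟨zero_le_one, le_rfl, fun s t hs ht => ?_⟩
  calc 1 * s + 0 * t = lpAdd p s 0 := by rw [lpAdd_zero_right hp hs]; ring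
    _ ≤ _ := lpAdd_mono hs le_rfl le_rfl ht

theorem isClosed_lpDualBall (p : ℝ≥0∞) : IsClosed (lpDualBall p) := by
  have : lpDualBall p = {z | 0 ≤ z.1} ∩ {z | 0 ≤ z.2} ∩ ⋂ s : ℝ, ⋂ t : ℝ, ⋂ _ : 0 ≤ s, ⋂ _ : 0 ≤ t,
      {z | z.1 * s + z.2 * t ≤ lpAdd p s t} := by
    ext z; simp [lpDualBall, and_assoc]
  rw [this]
  refine ((isClosed_le (by fun_prop) (by fun_prop)).inter
    (isClosed_le (by fun_prop) (by fun_prop))).inter ?_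
  exact isClosed_iInter fun s => isClosed_iInter fun t => isClosed_iInter fun _ =>
    isClosed_iInter fun _ => isClosed_le (by fun_prop) (by fun_prop)

theorem isCompact_lpDualBall {p : ℝ≥0∞} (hp : 1 ≤ p) : IsCompact (lpDualBall p) := by
  refine (isCompact_Icc (a := ((0 : ℝ), (0 : ℝ))) (b := ((1 : ℝ), (1 : ℝ)))).of_isClosed_subset
    (isClosed_lpDualBall p) ?_
  rintro ⟨a, b⟩ h
  exact ⟨⟨h.1, h.2.1⟩, ⟨lpDualBall_fst_le_one hp h, lpDualBall_snd_le_one hp h⟩⟩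

theorem convex_lpDualBall (p : ℝ≥0∞) : Convex ℝ (lpDualBall p) := by
  rintro ⟨a, b⟩ h ⟨a', b'⟩ h' l m hl hm hlm
  refine ⟨add_nonneg (mul_nonneg hl h.1) (mul_nonneg hm h'.1),
    add_nonneg (mul_nonneg hl h.2.1) (mul_nonneg hm h'.2.1), fun s t hs ht => ?_⟩
  have h1 := mul_le_mul_of_nonneg_left (h.2.2 s t hs ht) hl
  have h2 := mul_le_mul_of_nonneg_left (h'.2.2 s t hs ht) hm
  have h3 : l * lpAdd p s t + m * lpAdd p s t = lpAdd p s t := by rw [← add_mul, hlm, one_mul]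
  simp only [Prod.smul_mk, Prod.mk_add_mk, smul_eq_mul] at h1 h2 ⊢
  linarith

/-- The boundary point of the dual ball with outer normal `(s, t)`. -/
theorem rpow_div_mem_lpDualBall {q : ℝ} (hq : 1 < q) {s t : ℝ} (hs : 0 ≤ s) (ht : 0 ≤ t)
    (hst : 0 < s ^ q + t ^ q) :
    (s ^ (q - 1) / (s ^ q + t ^ q) ^ ((q - 1) / q),
      t ^ (q - 1) / (s ^ q + t ^ q) ^ ((q - 1) / q)) ∈ lpDualBall (ENNReal.ofReal q) := by
  refine ⟨by positivity, by positivity, fun x y hx hy => ?_⟩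
  have hqq : (q / (q - 1)).HolderConjugate q := (Real.HolderConjugate.conjExponent hq).symm
  have hq1 : 0 < q - 1 := by linarith
  have hq0 : 0 < q := by linarith
  -- Hölder with exponents `q / (q - 1)` and `q`; the power `q - 1` makes the first norm `(s ^ q + t
  -- ^ q) ^ ((q - 1) / q)`, the normalizing denominator.
  have key := Real.inner_le_Lp_mul_Lq_of_nonneg (Finset.univ : Finset (Fin 2))
    (f := ![s ^ (q - 1), t ^ (q - 1)]) (g := ![x, y]) hqq
    (by intro i _; fin_cases i <;> simp <;> positivity)
    (by intro i _; fin_cases i <;> simpa)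
  simp only [Fin.sum_univ_two, Matrix.cons_val_zero, Matrix.cons_val_one] at key
  rw [← Real.rpow_mul hs, ← Real.rpow_mul ht, mul_div_cancel₀ _ hq1.ne', one_div_div] at key
  have hr : (ENNReal.ofReal q).toReal = q := ENNReal.toReal_ofReal hq0.le
  rw [lpAdd, if_neg ENNReal.ofReal_ne_top, hr]
  have hpos : 0 < (s ^ q + t ^ q) ^ ((q - 1) / q) := Real.rpow_pos_of_pos hst _
  simp only
  rw [div_mul_eq_mul_div, div_mul_eq_mul_div, ← add_div, div_le_iff₀ hpos,
    mul_comm _ (_ ^ ((q - 1) / q))]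
  exact key

/-- This is the equality case of Hölder, so the point is extremal in the direction `(s, t)`. -/
theorem rpow_div_inner {q : ℝ} (hq : 1 < q) {s t : ℝ} (hs : 0 ≤ s) (ht : 0 ≤ t)
    (hst : 0 < s ^ q + t ^ q) :
    s ^ (q - 1) / (s ^ q + t ^ q) ^ ((q - 1) / q) * s +
      t ^ (q - 1) / (s ^ q + t ^ q) ^ ((q - 1) / q) * t = lpAdd (ENNReal.ofReal q) s t := by
  have hq0 : 0 < q := by linarith
  have hq1 : 0 < q - 1 := by linarith
  have hr : (ENNReal.ofReal q).toReal = q := ENNReal.toReal_ofReal hq0.le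
  rw [lpAdd, if_neg ENNReal.ofReal_ne_top, hr]
  have hpos : 0 < (s ^ q + t ^ q) ^ ((q - 1) / q) := Real.rpow_pos_of_pos hst _
  have e : ∀ x : ℝ, 0 ≤ x → x ^ (q - 1) * x = x ^ q := fun x hx => by
    nth_rewrite 2 [← Real.rpow_one x]
    rw [← Real.rpow_add_of_nonneg hx hq1.le zero_le_one, sub_add_cancel]
  rw [div_mul_eq_mul_div, div_mul_eq_mul_div, ← add_div, e s hs, e t ht, div_eq_iff hpos.ne',
    ← Real.rpow_add hst, ← add_div, add_sub_cancel, div_self hq0.ne', Real.rpow_one]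

/-- `lpAdd p` is the support function of its dual ball. -/
theorem exists_mem_lpDualBall_eq {p : ℝ≥0∞} (hp : 1 ≤ p) {s t : ℝ} (hs : 0 ≤ s) (ht : 0 ≤ t) :
    ∃ a b, (a, b) ∈ lpDualBall p ∧ a * s + b * t = lpAdd p s t := by
  by_cases hinf : p = ∞
  · rcases le_total s t with h | h
    · refine ⟨0, 1, lpDualBall_swap (one_zero_mem_lpDualBall hp), ?_⟩
      simp [lpAdd, hinf, h]
    · refine ⟨1, 0, one_zero_mem_lpDualBall hp, ?_⟩
      simp [lpAdd, hinf, h]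
  have h1 := one_le_toReal hp hinf
  rcases h1.eq_or_lt with h1 | h1
  · have e : ∀ s t, lpAdd p s t = s + t := fun s t => by simp [lpAdd, hinf, ← h1]
    refine ⟨1, 1, ⟨zero_le_one, zero_le_one, fun s t _ _ => ?_⟩, ?_⟩ <;> simp [e]
  · have hq0 : 0 < p.toReal := by linarith
    have e := ENNReal.ofReal_toReal hinf
    have h0 : 0 ≤ s ^ p.toReal + t ^ p.toReal := by positivity
    rcases h0.eq_or_lt with h0 | h0
    · refine ⟨1, 0, one_zero_mem_lpDualBall hp, ?_⟩
      have hs' : s = 0 := by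
        by_contra hne
        have := Real.rpow_pos_of_pos (lt_of_le_of_ne hs (Ne.symm hne)) p.toReal
        have := Real.rpow_nonneg ht p.toReal
        linarith
      rw [lpAdd, if_neg hinf, ← h0, hs', Real.zero_rpow (by positivity)]
      ring
    · have hm := rpow_div_mem_lpDualBall h1 hs ht h0
      have hi := rpow_div_inner h1 hs ht h0
      rw [e] at hm hi
      exact ⟨_, _, hm, hi⟩

/-! ### The `p`-difference body as a union -/

section

variable {E : Type*} [NormedAddCommGroup E] [InnerProductSpace ℝ E]

/-- The union of the bodies `a K - b K` with `(a, b)` in the dual ball. -/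
def dualBallSum (p : ℝ≥0∞) (K : Set E) : Set E :=
  {x | ∃ a b, (a, b) ∈ lpDualBall p ∧ x ∈ a • K - b • K}

theorem convex_dualBallSum (p : ℝ≥0∞) {K : Set E} (hK : Convex ℝ K) :
    Convex ℝ (dualBallSum p K) := by
  rintro x ⟨a, b, hab, x1, hx1, x2, hx2, rfl⟩ y ⟨a', b', hab', y1, hy1, y2, hy2, rfl⟩ l m hl hm hlm
  refine ⟨l * a + m * a', l * b + m * b', convex_lpDualBall p hab hab' hl hm hlm, ?_⟩
  rw [hK.add_smul (mul_nonneg hl hab.1) (mul_nonneg hm hab'.1),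
    hK.add_smul (mul_nonneg hl hab.2.1) (mul_nonneg hm hab'.2.1)]
  refine ⟨l • x1 + m • y1, add_mem_add ?_ ?_, l • x2 + m • y2, add_mem_add ?_ ?_, ?_⟩
  · rw [mul_smul]; exact smul_mem_smul_set hx1
  · rw [mul_smul]; exact smul_mem_smul_set hy1
  · rw [mul_smul]; exact smul_mem_smul_set hx2
  · rw [mul_smul]; exact smul_mem_smul_set hy2
  · simp only [smul_sub]; abel

theorem isCompact_dualBallSum {p : ℝ≥0∞} (hp : 1 ≤ p) {K : Set E} (hK : IsCompact K) :
    IsCompact (dualBallSum p K) := by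
  have : dualBallSum p K = (fun z : (ℝ × ℝ) × (E × E) => z.1.1 • z.2.1 - z.1.2 • z.2.2) ''
      (lpDualBall p ×ˢ (K ×ˢ K)) := by
    ext x
    constructor
    · rintro ⟨a, b, hab, _, ⟨y, hy, rfl⟩, _, ⟨z, hz, rfl⟩, rfl⟩
      exact ⟨((a, b), (y, z)), ⟨hab, hy, hz⟩, rfl⟩
    · rintro ⟨⟨⟨a, b⟩, y, z⟩, ⟨hab, hy, hz⟩, rfl⟩
      exact ⟨a, b, hab, _, smul_mem_smul_set hy, _, smul_mem_smul_set hz, rfl⟩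
  rw [this]
  exact ((isCompact_lpDualBall hp).prod (hK.prod hK)).image (by fun_prop)

theorem exists_inner_eq_supportFunction {K : Set E} (hK : IsCompact K) (hne : K.Nonempty) (u : E) :
    ∃ x ∈ K, ⟪x, u⟫ = supportFunction K u := by
  obtain ⟨x, hx, h⟩ := (hK.image (f := fun x : E => ⟪x, u⟫) (by fun_prop)).sSup_mem (hne.image _)
  exact ⟨x, hx, h⟩

/-- The `p`-difference body as a union of Minkowski sums. -/
theorem pDifferenceBody_eq_dualBallSum [CompleteSpace E] {p : ℝ≥0∞} (hp : 1 ≤ p) {K : Set E}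
    (hK : IsCompact K) (hc : Convex ℝ K) (h0 : (0 : E) ∈ K) :
    pDifferenceBody p K = dualBallSum p K := by
  have hn0 : (0 : E) ∈ -K := by simpa using h0
  apply Subset.antisymm
  · intro x hx
    by_contra hxD
    obtain ⟨f, r, hf, hr⟩ := geometric_hahn_banach_closed_point (convex_dualBallSum p hc)
      (isCompact_dualBallSum hp hK).isClosed hxD
    set u := (InnerProductSpace.toDual ℝ E).symm f with hu
    have hfu : ∀ y, f y = ⟪y, u⟫ := fun y => by
      rw [real_inner_comm, hu, InnerProductSpace.toDual_symm_apply]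
    obtain ⟨y, hy, hyu⟩ := exists_inner_eq_supportFunction hK ⟨0, h0⟩ u
    obtain ⟨z, hz, hzu⟩ := exists_inner_eq_supportFunction hK.neg ⟨0, hn0⟩ u
    -- The pair `(a, b)` at which `lpAdd` is attained gives a point of the union as far out in the
    -- direction `u` as the `p`-sum allows, contradicting the separation.
    obtain ⟨a, b, hab, he⟩ := exists_mem_lpDualBall_eq hp (supportFunction_nonneg hK h0 u)
      (supportFunction_nonneg hK.neg hn0 u)
    have hm : a • y - b • (-z) ∈ dualBallSum p K :=
      ⟨a, b, hab, _, smul_mem_smul_set hy, _, smul_mem_smul_set hz, rfl⟩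
    have h1 := hf _ hm
    have h2 := hx u
    rw [hfu, inner_sub_left, real_inner_smul_left, real_inner_smul_left, inner_neg_left, hyu,
      hzu] at h1
    rw [hfu] at hr
    linarith
  · rintro x ⟨a, b, hab, _, ⟨y, hy, rfl⟩, _, ⟨z, hz, rfl⟩, rfl⟩ u
    refine le_trans ?_ (hab.2.2 _ _ (supportFunction_nonneg hK h0 u)
      (supportFunction_nonneg hK.neg hn0 u))
    have h1 := mul_le_mul_of_nonneg_left (inner_le_supportFunction hK hy u) hab.1
    have h2 := mul_le_mul_of_nonneg_left (inner_le_supportFunction hK.neg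
      (neg_mem_neg.2 hz) u) hab.2.1
    rw [inner_neg_left] at h2
    simp only [inner_sub_left, real_inner_smul_left] at h1 h2 ⊢
    linarith

end

/-! ### Height function and area of the dual ball -/

/-- The height of the dual ball above `a`. -/
noncomputable def lpDualHeight (p : ℝ≥0∞) (a : ℝ) : ℝ := sSup {b | (a, b) ∈ lpDualBall p}

/-- The dual ball is closed and downward closed in the quadrant, so each vertical slice is a segment
starting on the axis. -/
theorem mem_lpDualBall_iff {p : ℝ≥0∞} (hp : 1 ≤ p) {a b : ℝ} (ha0 : 0 ≤ a) (ha1 : a ≤ 1) :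
    (a, b) ∈ lpDualBall p ↔ 0 ≤ b ∧ b ≤ lpDualHeight p a := by
  have hcl : IsClosed {b | (a, b) ∈ lpDualBall p} :=
    (isClosed_lpDualBall p).preimage (by fun_prop : Continuous fun b : ℝ => (a, b))
  have hne : {b | (a, b) ∈ lpDualBall p}.Nonempty :=
    ⟨0, lpDualBall_mono (one_zero_mem_lpDualBall hp) ha0 le_rfl ha1 le_rfl⟩
  have hbd : BddAbove {b | (a, b) ∈ lpDualBall p} := ⟨1, fun b hb => lpDualBall_snd_le_one hp hb⟩
  constructor
  · intro h
    exact ⟨h.2.1, le_csSup hbd h⟩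
  · rintro ⟨h, h'⟩
    exact lpDualBall_mono (hcl.csSup_mem hne hbd) ha0 h le_rfl h'

theorem lpDualHeight_nonneg {p : ℝ≥0∞} (hp : 1 ≤ p) {a : ℝ} (ha0 : 0 ≤ a) (ha1 : a ≤ 1) :
    0 ≤ lpDualHeight p a :=
  ((mem_lpDualBall_iff hp ha0 ha1).1
    (lpDualBall_mono (one_zero_mem_lpDualBall hp) ha0 le_rfl ha1 le_rfl)).2

theorem lpDualHeight_mem {p : ℝ≥0∞} (hp : 1 ≤ p) {a : ℝ} (ha0 : 0 ≤ a) (ha1 : a ≤ 1) :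
    (a, lpDualHeight p a) ∈ lpDualBall p :=
  (mem_lpDualBall_iff hp ha0 ha1).2 ⟨lpDualHeight_nonneg hp ha0 ha1, le_rfl⟩

theorem lpDualHeight_le_one {p : ℝ≥0∞} (hp : 1 ≤ p) {a : ℝ} (ha0 : 0 ≤ a) (ha1 : a ≤ 1) :
    lpDualHeight p a ≤ 1 :=
  lpDualBall_snd_le_one hp (lpDualHeight_mem hp ha0 ha1)

theorem lpDualHeight_zero {p : ℝ≥0∞} (hp : 1 ≤ p) : lpDualHeight p 0 = 1 :=
  le_antisymm (lpDualHeight_le_one hp le_rfl zero_le_one)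
    ((mem_lpDualBall_iff hp le_rfl zero_le_one).1
      (lpDualBall_swap (one_zero_mem_lpDualBall hp))).2

theorem antitoneOn_lpDualHeight {p : ℝ≥0∞} (hp : 1 ≤ p) :
    AntitoneOn (lpDualHeight p) (Icc 0 1) := fun _ ha _ hb hab =>
  ((mem_lpDualBall_iff hp ha.1 ha.2).1 (lpDualBall_mono (lpDualHeight_mem hp hb.1 hb.2) ha.1
    (lpDualHeight_nonneg hp hb.1 hb.2) hab le_rfl)).2

/-- The area of the dual ball. -/
noncomputable def lpDualArea (p : ℝ≥0∞) : ℝ := ∫ a in (0 : ℝ)..1, lpDualHeight p a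

/-- For a decreasing function the right-endpoint sum lies below the integral. Passing to left
endpoints exchanges the value at `1`, which is nonnegative, for the value `1` at `0`, at a cost of
at most `1 / n`. -/
theorem sum_lpDualHeight_le {p : ℝ≥0∞} (hp : 1 ≤ p) {n : ℕ} (hn : 0 < n) :
    (∑ j ∈ Finset.range n, lpDualHeight p (j / n)) / n ≤ lpDualArea p + 1 / n := by
  have hn' : (0 : ℝ) < n := Nat.cast_pos.2 hn
  have hanti : AntitoneOn (fun x : ℝ => lpDualHeight p (x / n)) (Icc 0 (0 + (n : ℝ))) := by
    intro x hx y hy hxy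
    rw [zero_add] at hx hy
    exact antitoneOn_lpDualHeight hp ⟨div_nonneg hx.1 hn'.le, div_le_one_of_le₀ hx.2 hn'.le⟩
      ⟨div_nonneg hy.1 hn'.le, div_le_one_of_le₀ hy.2 hn'.le⟩ (by gcongr)
  have h1 := hanti.sum_le_integral
  rw [zero_add, intervalIntegral.integral_comp_div _ hn'.ne', zero_div, div_self hn'.ne',
    smul_eq_mul] at h1
  have h2 := Finset.sum_range_succ' (fun j : ℕ => lpDualHeight p (j / n)) n
  have h3 := Finset.sum_range_succ (fun j : ℕ => lpDualHeight p (j / n)) n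
  have h4 := lpDualHeight_nonneg hp (zero_le_one) le_rfl
  rw [h2] at h3
  simp only [zero_add, Nat.cast_zero, zero_div, lpDualHeight_zero hp, div_self hn'.ne',
    Nat.cast_add, Nat.cast_one] at h1 h3
  rw [div_le_iff₀ hn', add_mul, one_div_mul_cancel hn'.ne', lpDualArea]
  linarith

/-! ### Coordinates and elementary areas in the plane -/

theorem Plane.inner_eq (x y : Plane) : ⟪x, y⟫ = x 0 * y 0 + x 1 * y 1 := by
  simp [PiLp.inner_apply, Fin.sum_univ_two, mul_comm]

theorem Plane.ext_coord {x y : Plane} (h0 : x 0 = y 0) (h1 : x 1 = y 1) : x = y := by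
  ext i
  fin_cases i
  · exact h0
  · exact h1

/-- The determinant of two vectors of the plane. -/
def cross (x y : Plane) : ℝ := x 0 * y 1 - x 1 * y 0

/-- The (possibly degenerate) triangle with vertices `0`, `v` and `w`. -/
def originTriangle (v w : Plane) : Set Plane :=
  {x | ∃ s t : ℝ, 0 ≤ s ∧ 0 ≤ t ∧ s + t ≤ 1 ∧ x = s • v + t • w}

/-- The linear map that sends the standard basis to `v`, `w`. -/
noncomputable def basisMap (v w : Plane) : Plane →ₗ[ℝ] Plane where
  toFun x := x 0 • v + x 1 • w
  map_add' x y := by simp only [PiLp.add_apply, add_smul]; abel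
  map_smul' c x := by simp [mul_smul]

theorem det_basisMap (v w : Plane) : LinearMap.det (basisMap v w) = cross v w := by
  rw [← LinearMap.det_toMatrix (EuclideanSpace.basisFun (Fin 2) ℝ).toBasis, Matrix.det_fin_two]
  simp [LinearMap.toMatrix_apply, basisMap, cross]
  ring

theorem volume_basisMap_image (v w : Plane) (s : Set Plane) :
    volume (basisMap v w '' s) = ENNReal.ofReal |cross v w| * volume s := by
  rw [Measure.addHaar_image_linearMap, det_basisMap]

/-- Coordinates on the plane. -/
theorem measurePreserving_coord :
    MeasurePreserving (fun x : Plane => (x 0, x 1)) volume volume :=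
  (volume_preserving_finTwoArrow ℝ).comp
    (EuclideanSpace.volume_preserving_symm_measurableEquiv_toLp (Fin 2))

theorem volume_coord_regionBetween {f : ℝ → ℝ} (hf : AntitoneOn f (Icc 0 1))
    (h0 : ∀ x ∈ Icc (0 : ℝ) 1, 0 ≤ f x) :
    volume {x : Plane | x 0 ∈ Ioo (0 : ℝ) 1 ∧ 0 < x 1 ∧ x 1 < f (x 0)} =
      ENNReal.ofReal (∫ x in (0 : ℝ)..1, f x) := by
  have hi : IntegrableOn f (Ioo 0 1) :=
    (hf.integrableOn_of_measure_ne_top (isLeast_Icc zero_le_one) (isGreatest_Icc zero_le_one)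
      (by simp) measurableSet_Icc).mono_set Ioo_subset_Icc_self
  have hm : AEMeasurable f (volume.restrict (Ioo 0 1)) := hi.aemeasurable
  have key := volume_regionBetween_eq_integral (μ := volume) (f := fun _ => (0 : ℝ)) (g := f)
    (s := Ioo (0 : ℝ) 1) (integrableOn_const (by simp)) hi measurableSet_Ioo
    (fun x hx => h0 x (Ioo_subset_Icc_self hx))
  have hnull : NullMeasurableSet (regionBetween (fun _ => (0 : ℝ)) f (Ioo (0 : ℝ) 1))
      (volume : Measure (ℝ × ℝ)) := by
    -- Nothing is known about `f` off the interval, so it is cut off by an indicator, which leaves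
    -- the region unchanged.
    have h := nullMeasurableSet_regionBetween (volume : Measure ℝ) (s := Ioo (0 : ℝ) 1)
      (f := fun _ => (0 : ℝ))
      (g := (Ioo (0 : ℝ) 1).indicator f) aemeasurable_const
      ((aemeasurable_indicator_iff measurableSet_Ioo).2 hm) measurableSet_Ioo.nullMeasurableSet
    have e : regionBetween (fun _ => (0 : ℝ)) ((Ioo (0 : ℝ) 1).indicator f) (Ioo (0 : ℝ) 1) =
        regionBetween (fun _ => (0 : ℝ)) f (Ioo (0 : ℝ) 1) := by
      ext x
      refine and_congr_right fun hx => ?_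
      rw [indicator_of_mem hx]
    rw [← e]
    exact h
  rw [← Measure.volume_eq_prod, ← measurePreserving_coord.measure_preimage hnull] at key
  rw [intervalIntegral.integral_of_le zero_le_one, integral_Ioc_eq_integral_Ioo]
  simp only [Pi.sub_apply, sub_zero] at key
  exact key

theorem volume_line {u : Plane} (hu : u ≠ 0) (c : ℝ) : volume {x : Plane | ⟪x, u⟫ = c} = 0 := by
  have h0 : volume {x : Plane | ⟪x, u⟫ = 0} = 0 := by
    have := Measure.addHaar_submodule (volume : Measure Plane) (LinearMap.ker (innerₛₗ ℝ u)) (by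
      intro h
      have : u ∈ LinearMap.ker (innerₛₗ ℝ u) := h ▸ Submodule.mem_top
      simp at this
      exact hu this)
    convert this using 2
    ext x
    simp [real_inner_comm]
  set z := (c / ⟪u, u⟫) • u with hz
  have hzu : ⟪z, u⟫ = c := by
    rw [hz, real_inner_smul_left, div_mul_cancel₀]
    exact (inner_self_ne_zero (𝕜 := ℝ)).2 hu
  rw [← measure_preimage_add_right volume z]
  convert h0 using 2
  ext x
  simp only [mem_preimage, mem_ofPred_eq, inner_add_left, hzu, add_eq_right]

theorem volume_axis (i : Fin 2) : volume {x : Plane | x i = 0} = 0 := by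
  have h : EuclideanSpace.single i (1 : ℝ) ≠ (0 : Plane) := by simp
  convert volume_line h 0 using 2
  ext x
  rw [mem_ofPred_eq, mem_ofPred_eq, real_inner_comm, EuclideanSpace.inner_single_left]
  simp

theorem volume_standard_triangle_interior :
    volume {x : Plane | x 0 ∈ Ioo (0 : ℝ) 1 ∧ 0 < x 1 ∧ x 1 < 1 - x 0} =
      ENNReal.ofReal (1 / 2) := by
  rw [volume_coord_regionBetween (f := fun x => 1 - x)]
  · congr 1
    rw [intervalIntegral.integral_sub (by simp) (by simp)]
    norm_num
  · intro x _ y _ h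
    simp only
    linarith
  · intro x hx
    simpa using hx.2

/-- The closed triangle exceeds the open one only by parts of three lines. -/
theorem volume_standard_triangle :
    volume {x : Plane | 0 ≤ x 0 ∧ 0 ≤ x 1 ∧ x 0 + x 1 ≤ 1} = ENNReal.ofReal (1 / 2) := by
  rw [← volume_standard_triangle_interior]
  apply le_antisymm
  · have hsub : {x : Plane | 0 ≤ x 0 ∧ 0 ≤ x 1 ∧ x 0 + x 1 ≤ 1} ⊆
        {x : Plane | x 0 ∈ Ioo (0 : ℝ) 1 ∧ 0 < x 1 ∧ x 1 < 1 - x 0} ∪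
          ({x | x 0 = 0} ∪ {x | x 1 = 0} ∪
          {x | ⟪x, (!₂[1, 1] : Plane)⟫ = 1}) := by
      rintro x ⟨h0, h1, h2⟩
      by_cases e0 : x 0 = 0
      · exact Or.inr (Or.inl (Or.inl e0))
      by_cases e1 : x 1 = 0
      · exact Or.inr (Or.inl (Or.inr e1))
      by_cases e2 : x 0 + x 1 = 1
      · right; right
        simp [Plane.inner_eq, e2]
      · have h0' := lt_of_le_of_ne h0 (Ne.symm e0)
        have h1' := lt_of_le_of_ne h1 (Ne.symm e1)
        have h2' := lt_of_le_of_ne h2 e2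
        exact Or.inl ⟨⟨h0', by linarith⟩, h1', by linarith⟩
    have hnz : (!₂[1, 1] : Plane) ≠ 0 := fun h => by simpa using congrArg (fun x : Plane => x 0) h
    refine (measure_mono hsub).trans ((measure_union_le _ _).trans ?_)
    rw [measure_union_null (measure_union_null (volume_axis 0) (volume_axis 1))
      (volume_line hnz 1), add_zero]
  · refine measure_mono ?_
    rintro x ⟨⟨h0, _⟩, h1, h2⟩
    exact ⟨h0.le, h1.le, by linarith⟩

theorem originTriangle_eq_image (v w : Plane) :
    originTriangle v w = basisMap v w '' {x : Plane | 0 ≤ x 0 ∧ 0 ≤ x 1 ∧ x 0 + x 1 ≤ 1} := by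
  ext x
  constructor
  · rintro ⟨s, t, hs, ht, hst, rfl⟩
    exact ⟨!₂[s, t], by simp [hs, ht, hst], by simp [basisMap]⟩
  · rintro ⟨y, ⟨h0, h1, h2⟩, rfl⟩
    exact ⟨y 0, y 1, h0, h1, h2, rfl⟩

theorem volume_originTriangle (v w : Plane) :
    volume.real (originTriangle v w) = |cross v w| / 2 := by
  rw [Measure.real, originTriangle_eq_image, volume_basisMap_image, volume_standard_triangle,
    ENNReal.toReal_mul, ENNReal.toReal_ofReal (abs_nonneg _), ENNReal.toReal_ofReal (by norm_num)]
  ring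

theorem isCompact_originTriangle (v w : Plane) : IsCompact (originTriangle v w) := by
  have : originTriangle v w = (fun z : ℝ × ℝ => z.1 • v + z.2 • w) ''
      (Icc (0, 0) (1, 1) ∩ {z | z.1 + z.2 ≤ 1}) := by
    ext x
    constructor
    · rintro ⟨s, t, hs, ht, hst, rfl⟩
      exact ⟨(s, t), ⟨⟨⟨hs, ht⟩, ⟨by simp only; linarith, by simp only; linarith⟩⟩, hst⟩, rfl⟩
    · rintro ⟨⟨s, t⟩, ⟨⟨⟨hs, ht⟩, _⟩, hst⟩, rfl⟩
      exact ⟨s, t, hs, ht, hst, rfl⟩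
  rw [this]
  exact (isCompact_Icc.inter_right (isClosed_le (by fun_prop) (by fun_prop))).image (by fun_prop)

/-! ### Circumscribed polygons and their areas -/

/-- A cyclic sequence of directions in counterclockwise order. -/
structure IsFan (n : ℕ) (u : ℕ → Plane) : Prop where
  pos : 0 < n
  periodic : ∀ j, u (j + n) = u j
  cross_pos : ∀ j, 0 < cross (u j) (u (j + 1))
  cross_gap : ∀ i j, 0 < cross (u j) (u i) → cross (u i) (u (j + 1)) ≤ 0
  not_parallel : ∀ i < n, ∀ j < n, i ≠ j → ∀ c : ℝ, 0 < c → u (i + 1) ≠ c • u (j + 1)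
  spanning : ∀ x : Plane, (∀ j, ⟪x, u j⟫ ≤ 0) → x = 0

/-- A positive sublinear functional: the support function of a body around the origin. -/
structure IsGauge (H : Plane → ℝ) : Prop where
  smul : ∀ c : ℝ, 0 ≤ c → ∀ u, H (c • u) = c * H u
  add_le : ∀ u v, H (u + v) ≤ H u + H v
  pos : ∀ u, u ≠ 0 → 0 < H u

/-- The intersection point of the support lines with normals `u j` and `u (j + 1)`. -/
noncomputable def fanVertex (u : ℕ → Plane) (H : Plane → ℝ) (j : ℕ) : Plane :=
  (cross (u j) (u (j + 1)))⁻¹ • !₂[H (u j) * u (j + 1) 1 - H (u (j + 1)) * u j 1,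
    H (u (j + 1)) * u j 0 - H (u j) * u (j + 1) 0]

/-- The polygon circumscribed with outer normals `u j`. -/
def fanPolygon (u : ℕ → Plane) (H : Plane → ℝ) : Set Plane :=
  {x | ∀ j, ⟪x, u j⟫ ≤ H (u j)}

/-- The Cauchy–Binet identity: it reads off the orientation of two points from their inner products
with two normals. -/
theorem inner_mul_inner_sub (v w a b : Plane) :
    cross v w * cross a b = ⟪v, a⟫ * ⟪w, b⟫ - ⟪v, b⟫ * ⟪w, a⟫ := by
  simp only [Plane.inner_eq, cross]; ring

namespace IsFan

variable {n : ℕ} {u : ℕ → Plane} (hu : IsFan n u) {H : Plane → ℝ} (hH : IsGauge H)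
include hu

theorem ne_zero (j : ℕ) : u j ≠ 0 := fun h => by
  have := hu.cross_pos j
  simp [h, cross] at this

theorem inner_fanVertex_left (H : Plane → ℝ) (j : ℕ) : ⟪fanVertex u H j, u j⟫ = H (u j) := by
  have := (hu.cross_pos j).ne'
  simp only [fanVertex, real_inner_smul_left]
  rw [inv_mul_eq_iff_eq_mul₀ this]
  simp [Plane.inner_eq, cross]
  ring

theorem inner_fanVertex_right (H : Plane → ℝ) (j : ℕ) :
    ⟪fanVertex u H j, u (j + 1)⟫ = H (u (j + 1)) := by
  have := (hu.cross_pos j).ne'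
  simp only [fanVertex, real_inner_smul_left]
  rw [inv_mul_eq_iff_eq_mul₀ this]
  simp [Plane.inner_eq, cross]
  ring

include hH in
-- Write `u i` in the basis `u j`, `u (j + 1)`. By `cross_gap` no fan direction lies strictly inside
-- this sector, so at most one coefficient is positive. Moving the other term to the opposite side,
-- sublinearity of `H` gives the inequality.
theorem fanVertex_mem (j : ℕ) : fanVertex u H j ∈ fanPolygon u H := by
  intro i
  have hc := hu.cross_pos j
  have hgap := hu.cross_gap i j
  set a := cross (u i) (u (j + 1)) with ha
  set b := cross (u j) (u i) with hb
  set c := cross (u j) (u (j + 1)) with hc'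
  have hdec : c • u i = a • u j + b • u (j + 1) := by
    apply Plane.ext_coord <;> simp [ha, hb, hc', cross] <;> ring
  have hin : c * ⟪fanVertex u H j, u i⟫ = a * H (u j) + b * H (u (j + 1)) := by
    rw [← real_inner_smul_right, hdec, inner_add_right, real_inner_smul_right,
      real_inner_smul_right, hu.inner_fanVertex_left, hu.inner_fanVertex_right]
  have p1 := hH.pos _ (hu.ne_zero j)
  have p2 := hH.pos _ (hu.ne_zero (j + 1))
  have p3 := hH.pos _ (hu.ne_zero i)
  refine le_of_mul_le_mul_left ?_ hc
  rw [hin]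
  rcases lt_or_ge 0 b with h | h
  · have ha0 := hgap h
    have e : b • u (j + 1) = c • u i + (-a) • u j := by rw [hdec]; module
    have := hH.add_le (c • u i) ((-a) • u j)
    rw [← e, hH.smul _ h.le, hH.smul _ hc.le, hH.smul _ (by linarith)] at this
    linarith
  · rcases lt_or_ge 0 a with h' | h'
    · have e : a • u j = c • u i + (-b) • u (j + 1) := by rw [hdec]; module
      have := hH.add_le (c • u i) ((-b) • u (j + 1))
      rw [← e, hH.smul _ h'.le, hH.smul _ hc.le, hH.smul _ (by linarith)] at this
      linarith
    · have := mul_nonpos_of_nonpos_of_nonneg h' p1.le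
      have := mul_nonpos_of_nonpos_of_nonneg h p2.le
      have := mul_pos hc p3
      linarith

include hH in
-- Both vertices lie on the line with normal `u (j + 1)`; the first respects the constraint of `u (j
-- + 2)`, which the second meets with equality. This fixes their order.
theorem cross_fanVertex_nonneg (j : ℕ) :
    0 ≤ cross (fanVertex u H j) (fanVertex u H (j + 1)) := by
  have h := inner_mul_inner_sub (fanVertex u H j) (fanVertex u H (j + 1)) (u (j + 1)) (u (j + 2))
  rw [hu.inner_fanVertex_right, hu.inner_fanVertex_left, hu.inner_fanVertex_right] at h
  have h1 := hu.fanVertex_mem hH j (j + 2)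
  have h2 := hu.cross_pos (j + 1)
  have h3 := hH.pos _ (hu.ne_zero (j + 1))
  refine nonneg_of_mul_nonneg_left (b := cross (u (j + 1)) (u (j + 2))) ?_ h2
  rw [h]
  nlinarith

include hH in
-- The point `z` lies on the edge with normal `u (j + 1)` scaled by `m`, between the neighbouring
-- support lines. Cramer's rule then writes `z` in the two vertices with nonnegative coefficients of
-- sum `m`.
theorem mem_smul_originTriangle {z : Plane} {m : ℝ} (hm : 0 ≤ m) (hm1 : m ≤ 1) {j : ℕ}
    (h : ⟪z, u (j + 1)⟫ = m * H (u (j + 1))) (h0 : ⟪z, u j⟫ ≤ m * H (u j))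
    (h2 : ⟪z, u (j + 2)⟫ ≤ m * H (u (j + 2))) :
    z ∈ originTriangle (fanVertex u H j) (fanVertex u H (j + 1)) := by
  have hpos := hH.pos _ (hu.ne_zero (j + 1))
  have i1 := hu.inner_fanVertex_left H j
  have i2 := hu.inner_fanVertex_right H j
  have i3 := hu.inner_fanVertex_left H (j + 1)
  have i4 := hu.inner_fanVertex_right H (j + 1)
  have c1 := hu.cross_pos j
  have c2 := hu.cross_pos (j + 1)
  have hD := hu.cross_fanVertex_nonneg hH j
  set v := fanVertex u H j
  set w := fanVertex u H (j + 1)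
  have e1 := inner_mul_inner_sub z w (u (j + 1)) (u (j + 2))
  have e2 := inner_mul_inner_sub v z (u j) (u (j + 1))
  rw [h, i3, i4] at e1
  rw [h, i1, i2] at e2
  have n1 : 0 ≤ cross z w := by
    refine nonneg_of_mul_nonneg_left (b := cross (u (j + 1)) (u (j + 2))) ?_ c2
    rw [e1]; nlinarith
  have n2 : 0 ≤ cross v z := by
    refine nonneg_of_mul_nonneg_left (b := cross (u j) (u (j + 1))) ?_ c1
    rw [e2]; nlinarith
  have hz : cross v w • z = cross z w • v + cross v z • w := by
    apply Plane.ext_coord <;> simp [cross] <;> ring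
  have hs : cross z w + cross v z = cross v w * m := by
    have := congrArg (fun x => ⟪x, u (j + 1)⟫) hz
    simp only [inner_add_left, real_inner_smul_left, h, i2, i3] at this
    have h' : H (u (j + 1)) * (cross z w + cross v z - cross v w * m) = 0 := by linarith
    have := (mul_eq_zero.1 h').resolve_left hpos.ne'
    linarith
  rcases hD.eq_or_lt with hD | hD
  -- An edge may degenerate. Then `z = m • v`, which is tested against the basis `u j`, `u (j + 1)`.
  · have hv0 : cross v z = 0 := by rw [← hD, zero_mul] at hs; linarith
    refine ⟨m, 0, hm, le_rfl, by linarith, ?_⟩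
    rw [zero_smul, add_zero]
    have h0' : ⟪z - m • v, u j⟫ = 0 := by
      rw [hv0, zero_mul] at e2
      rw [inner_sub_left, real_inner_smul_left, i1]
      have : H (u (j + 1)) * (m * H (u j) - ⟪z, u j⟫) = 0 := by linarith
      have := (mul_eq_zero.1 this).resolve_left hpos.ne'
      linarith
    have h1' : ⟪z - m • v, u (j + 1)⟫ = 0 := by
      rw [inner_sub_left, real_inner_smul_left, i2, h, sub_self]
    rw [← sub_eq_zero]
    rw [Plane.inner_eq] at h0' h1'
    have hc := c1.ne'
    apply Plane.ext_coord
    · refine (mul_eq_zero.1 (?_ : cross (u j) (u (j + 1)) * (z - m • v) 0 = 0)).resolve_left hc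
      simp only [cross]; linear_combination (u (j + 1) 1) * h0' - (u j 1) * h1'
    · refine (mul_eq_zero.1 (?_ : cross (u j) (u (j + 1)) * (z - m • v) 1 = 0)).resolve_left hc
      simp only [cross]; linear_combination (u j 0) * h1' - (u (j + 1) 0) * h0'
  · refine ⟨cross z w / cross v w, cross v z / cross v w, by positivity, by positivity, ?_, ?_⟩
    · rw [← add_div, hs, mul_div_cancel_left₀ _ hD.ne']; exact hm1
    · rw [div_eq_inv_mul, div_eq_inv_mul, mul_smul, mul_smul, ← smul_add, ← hz, smul_smul,
        inv_mul_cancel₀ hD.ne', one_smul]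

theorem periodic_mul (j k : ℕ) : u (j + k * n) = u j := by
  induction k with
  | zero => simp
  | succ k ih => rw [Nat.succ_mul, ← add_assoc, hu.periodic, ih]

/-- Triangle `j` stands on the edge with normal `u (j + 1)`, so the directions are indexed with this
shift. -/
theorem exists_lt_succ (k : ℕ) : ∃ j < n, u k = u (j + 1) := by
  have hn := hu.pos
  refine ⟨(k + (n - 1)) % n, Nat.mod_lt _ hn, ?_⟩
  have h := Nat.mod_add_div (k + (n - 1)) n
  rw [← hu.periodic k, ← hu.periodic_mul ((k + (n - 1)) % n + 1) ((k + (n - 1)) / n)]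
  congr 1
  rw [mul_comm] at h
  omega

include hH in
-- The largest ratio `⟪x, u k⟫ / H (u k)` is the gauge of the polygon at `x`, and a maximizing
-- normal names a triangle that contains `x`.
theorem fanPolygon_eq : fanPolygon u H =
    ⋃ j ∈ Finset.range n, originTriangle (fanVertex u H j) (fanVertex u H (j + 1)) := by
  apply Subset.antisymm
  · intro x hx
    obtain ⟨j, hj, hmax⟩ := Finset.exists_max_image (Finset.range n)
      (fun j => ⟪x, u (j + 1)⟫ / H (u (j + 1))) ⟨0, Finset.mem_range.2 hu.pos⟩
    have hpos : ∀ k, 0 < H (u k) := fun k => hH.pos _ (hu.ne_zero k)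
    set m := ⟪x, u (j + 1)⟫ / H (u (j + 1)) with hm
    have hall : ∀ k, ⟪x, u k⟫ ≤ m * H (u k) := by
      intro k
      obtain ⟨i, hi, he⟩ := hu.exists_lt_succ k
      rw [he, ← div_le_iff₀ (hpos _)]
      exact hmax i (Finset.mem_range.2 hi)
    refine mem_biUnion hj ?_
    rcases le_or_gt m 0 with h0 | h0
    · have : x = 0 := hu.spanning x fun k =>
        (hall k).trans (mul_nonpos_of_nonpos_of_nonneg h0 (hpos k).le)
      exact ⟨0, 0, le_rfl, le_rfl, by norm_num, by simp [this]⟩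
    · refine hu.mem_smul_originTriangle hH h0.le ?_ ?_ (hall _) (hall _)
      · rw [hm, div_le_one (hpos _)]
        exact hx _
      · rw [hm, div_mul_cancel₀ _ (hpos _).ne']
  · refine iUnion₂_subset fun j _ => ?_
    rintro x ⟨s, t, hs, ht, hst, rfl⟩ k
    have h1 := mul_le_mul_of_nonneg_left (hu.fanVertex_mem hH j k) hs
    have h2 := mul_le_mul_of_nonneg_left (hu.fanVertex_mem hH (j + 1) k) ht
    have h3 := hH.pos _ (hu.ne_zero k)
    rw [inner_add_left, real_inner_smul_left, real_inner_smul_left]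
    nlinarith

include hH in
theorem isCompact_fanPolygon : IsCompact (fanPolygon u H) := by
  rw [hu.fanPolygon_eq hH]
  exact (Finset.range n).isCompact_biUnion fun j _ => isCompact_originTriangle _ _

include hH in
-- On triangle `j` the ratio `⟪x, u k⟫ / H (u k)` is maximal at `k = j + 1`. Hence two triangles
-- meet only where two such ratios agree, which is a line.
theorem inner_le_of_mem_originTriangle {x : Plane} {j : ℕ}
    (hx : x ∈ originTriangle (fanVertex u H j) (fanVertex u H (j + 1))) (k : ℕ) :
    ⟪x, u k⟫ * H (u (j + 1)) ≤ ⟪x, u (j + 1)⟫ * H (u k) := by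
  obtain ⟨s, t, hs, ht, hst, rfl⟩ := hx
  have h1 := mul_le_mul_of_nonneg_left (hu.fanVertex_mem hH j k) hs
  have h2 := mul_le_mul_of_nonneg_left (hu.fanVertex_mem hH (j + 1) k) ht
  have h3 := hH.pos _ (hu.ne_zero (j + 1))
  rw [inner_add_left, real_inner_smul_left, real_inner_smul_left, inner_add_left,
    real_inner_smul_left, real_inner_smul_left, hu.inner_fanVertex_left H (j + 1),
    hu.inner_fanVertex_right H j]
  nlinarith

include hH in
theorem volume_fanPolygon : volume.real (fanPolygon u H) =
    ∑ j ∈ Finset.range n, cross (fanVertex u H j) (fanVertex u H (j + 1)) / 2 := by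
  rw [hu.fanPolygon_eq hH, measureReal_biUnion_finset₀ ?_ ?_
    fun j _ => (isCompact_originTriangle _ _).measure_lt_top.ne]
  · refine Finset.sum_congr rfl fun j _ => ?_
    rw [volume_originTriangle, abs_of_nonneg (hu.cross_fanVertex_nonneg hH j)]
  · intro i hi j hj hij
    have hpos : ∀ k, 0 < H (u k) := fun k => hH.pos _ (hu.ne_zero k)
    refine measure_mono_null (t := {x : Plane |
      ⟪x, H (u (j + 1)) • u (i + 1) - H (u (i + 1)) • u (j + 1)⟫ = 0}) ?_ (volume_line ?_ 0)
    · rintro x ⟨h1, h2⟩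
      have h1 := hu.inner_le_of_mem_originTriangle hH h1 (j + 1)
      have h2 := hu.inner_le_of_mem_originTriangle hH h2 (i + 1)
      simp only [mem_ofPred_eq, inner_sub_right, real_inner_smul_right]
      linarith
    · intro h
      refine hu.not_parallel i (Finset.mem_range.1 hi) j (Finset.mem_range.1 hj) hij
        (H (u (i + 1)) / H (u (j + 1))) (div_pos (hpos _) (hpos _)) ?_
      rw [div_eq_inv_mul, mul_smul, ← sub_eq_zero.1 h, smul_smul, inv_mul_cancel₀ (hpos _).ne',
        one_smul]
  · exact fun j _ => (isCompact_originTriangle _ _).isClosed.measurableSet.nullMeasurableSet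

end IsFan

/-! ### Regular fans and approximation of bodies by polygons -/

/-- Unit vector with polar angle `t`. -/
noncomputable def unitVec (t : ℝ) : Plane := !₂[Real.cos t, Real.sin t]

theorem cross_unitVec (s t : ℝ) : cross (unitVec s) (unitVec t) = Real.sin (t - s) := by
  simp [cross, unitVec, Real.sin_sub]; ring

/-- The vertices of the regular `n`-gon. -/
noncomputable def regularFan (n : ℕ) (j : ℕ) : Plane := unitVec (j * (2 * Real.pi / n))

theorem isFan_regularFan {k : ℕ} (hk : 0 < k) : IsFan (4 * k) (regularFan (4 * k)) := by
  have hn : 0 < 4 * k := by omega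
  have hn4 : (4 : ℝ) ≤ ((4 * k : ℕ) : ℝ) := by exact_mod_cast (by omega : 4 ≤ 4 * k)
  set n := 4 * k with hnk
  have hn' : (0 : ℝ) < n := by linarith
  set δ := 2 * Real.pi / n with hδ
  have hpi := Real.pi_pos
  have hδ0 : 0 < δ := by positivity
  have hnδ : n * δ = 2 * Real.pi := by rw [hδ]; field_simp
  have hδπ : δ < Real.pi := by nlinarith
  refine ⟨hn, ?_, ?_, ?_, ?_, ?_⟩
  · intro j
    simp only [regularFan, Nat.cast_add, add_mul, ← hδ, hnδ, unitVec, Real.cos_add_two_pi,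
      Real.sin_add_two_pi]
  · intro j
    rw [regularFan, regularFan, cross_unitVec]
    refine Real.sin_pos_of_pos_of_lt_pi ?_ ?_ <;> push_cast <;> rw [← hδ] <;> linarith
  · intro i j
    rw [regularFan, regularFan, regularFan, cross_unitVec, cross_unitVec, ← hδ]
    -- Only the residue `r` of `i - j` modulo `n` matters. Positivity of `sin (r δ)` forces `r ≥ 1`
    -- and `r δ < π`, so `sin ((r - 1) δ) ≥ 0`.
    set q : ℤ := ((i : ℤ) - j) / n with hq
    set r : ℤ := ((i : ℤ) - j) % n with hr
    have hdiv : (i : ℤ) - j = r + n * q := (Int.emod_add_mul_ediv _ _).symm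
    have hdivR : (i : ℝ) - j = r + n * q := by exact_mod_cast hdiv
    have hr0 : 0 ≤ r := Int.emod_nonneg _ (by omega)
    have hrn : r < n := Int.emod_lt_of_pos _ (by omega)
    have hrnR : (r : ℝ) < n := by exact_mod_cast hrn
    have e1 : (i : ℝ) * δ - j * δ = r * δ + q * (2 * Real.pi) := by
      rw [← hnδ]; linear_combination δ * hdivR
    have e2 : ((j + 1 : ℕ) : ℝ) * δ - i * δ = -(((r : ℝ) - 1) * δ) - q * (2 * Real.pi) := by
      rw [← hnδ]; push_cast; linear_combination -δ * hdivR
    rw [e1, e2, Real.sin_add_int_mul_two_pi, Real.sin_sub_int_mul_two_pi, Real.sin_neg]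
    intro hpos
    have h1 : 1 ≤ r := by
      by_contra hlt
      have : r = 0 := by omega
      simp [this] at hpos
    have h1R : (1 : ℝ) ≤ r := by exact_mod_cast h1
    have h2 : (r : ℝ) * δ < Real.pi := by
      by_contra! hge
      have hlt : (r : ℝ) * δ < 2 * Real.pi := by rw [← hnδ]; gcongr
      have := Real.sin_nonneg_of_nonneg_of_le_pi (x := r * δ - Real.pi) (by linarith) (by linarith)
      rw [Real.sin_sub_pi] at this
      linarith
    have := Real.sin_nonneg_of_nonneg_of_le_pi (x := ((r : ℝ) - 1) * δ)
      (mul_nonneg (by linarith) hδ0.le) (by linarith)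
    linarith
  · intro i hi j hj hij c hc h
    have h0 := congrArg (fun x : Plane => x 0) h
    have h1 := congrArg (fun x : Plane => x 1) h
    simp only [regularFan, unitVec, PiLp.smul_apply, Matrix.cons_val_zero, Matrix.cons_val_one,
      smul_eq_mul, ← hδ] at h0 h1
    set s := ((i + 1 : ℕ) : ℝ) * δ with hs
    set t := ((j + 1 : ℕ) : ℝ) * δ with ht
    have hs1 := Real.sin_sq_add_cos_sq s
    have ht1 := Real.sin_sq_add_cos_sq t
    have hc1 : c = 1 := by
      have : c ^ 2 = 1 := by rw [h0, h1] at hs1; linear_combination hs1 - c ^ 2 * ht1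
      nlinarith
    rw [hc1, one_mul] at h0 h1
    have hcos : Real.cos (s - t) = 1 := by rw [Real.cos_sub, h0, h1]; linarith
    have hiR : (i : ℝ) + 1 ≤ n := by exact_mod_cast hi
    have hjR : (j : ℝ) + 1 ≤ n := by exact_mod_cast hj
    have hi0 : (0 : ℝ) ≤ i := Nat.cast_nonneg i
    have hj0 : (0 : ℝ) ≤ j := Nat.cast_nonneg j
    have b1 : s ≤ 2 * Real.pi := by rw [hs, ← hnδ]; push_cast; gcongr
    have b2 : t ≤ 2 * Real.pi := by rw [ht, ← hnδ]; push_cast; gcongr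
    have b3 : 0 < s := by positivity
    have b4 : 0 < t := by positivity
    have := (Real.cos_eq_one_iff_of_lt_of_lt (by linarith) (by linarith)).1 hcos
    have hst : ((i + 1 : ℕ) : ℝ) * δ = ((j + 1 : ℕ) : ℝ) * δ := by linarith
    have := mul_right_cancel₀ hδ0.ne' hst
    have : i + 1 = j + 1 := by exact_mod_cast this
    omega
  · intro x hx
    -- As the number of directions is `4 k`, the four axis directions are among them, and they
    -- already force `x = 0`.
    have hkδ : (k : ℝ) * δ = Real.pi / 2 := by
      have : (n : ℝ) = 4 * k := by rw [hnk]; push_cast; ring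
      rw [this] at hnδ; linarith
    have a0 := hx 0
    have a1 := hx k
    have a2 := hx (2 * k)
    have a3 := hx (3 * k)
    have e2 : 2 * (k : ℝ) * δ = Real.pi := by linarith
    have e3 : 3 * (k : ℝ) * δ = Real.pi / 2 + Real.pi := by linarith
    simp only [regularFan, unitVec, Plane.inner_eq, Matrix.cons_val_zero, Matrix.cons_val_one,
      ← hδ, Nat.cast_mul, Nat.cast_ofNat, Nat.cast_zero, zero_mul, e2, e3, hkδ,
      Real.cos_add_pi, Real.sin_add_pi, Real.cos_zero, Real.sin_zero, Real.cos_pi, Real.sin_pi,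
      Real.cos_pi_div_two, Real.sin_pi_div_two] at a0 a1 a2 a3
    apply Plane.ext_coord <;> simp <;> linarith

theorem exists_eq_smul_unitVec (w : Plane) : ∃ r t : ℝ, 0 ≤ r ∧ 0 ≤ t ∧ w = r • unitVec t := by
  set z : ℂ := ⟨w 0, w 1⟩ with hz
  refine ⟨‖z‖, z.arg + 2 * Real.pi, norm_nonneg _, ?_, ?_⟩
  · have := Complex.neg_pi_lt_arg z
    have := Real.pi_pos
    linarith
  · apply Plane.ext_coord
    · simp [unitVec, Complex.norm_mul_cos_arg, hz]
    · simp [unitVec, Complex.norm_mul_sin_arg, hz]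

theorem continuous_supportFunction {K : Set Plane} (hK : IsCompact K) (h0 : K.Nonempty) :
    Continuous (supportFunction K) := by
  obtain ⟨R, hR⟩ := hK.isBounded.exists_norm_le
  have hR0 : 0 ≤ R := (norm_nonneg _).trans (hR _ h0.some_mem)
  refine (LipschitzWith.of_le_add_mul ⟨R, hR0⟩ fun u v => ?_).continuous
  have h1 := supportFunction_add_le hK h0 v (u - v)
  rw [add_sub_cancel] at h1
  refine h1.trans (add_le_add le_rfl (supportFunction_le h0 fun x hx => ?_))
  rw [dist_eq_norm]
  exact (real_inner_le_norm _ _).trans (mul_le_mul_of_nonneg_right (hR x hx) (norm_nonneg _))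

theorem mem_of_forall_inner_le {K : Set Plane} (hK : IsCompact K) (hc : Convex ℝ K)
    (h0 : K.Nonempty) {x : Plane} (hx : ∀ u, ⟪x, u⟫ ≤ supportFunction K u) : x ∈ K := by
  by_contra hxK
  obtain ⟨f, r, hf, hr⟩ := geometric_hahn_banach_closed_point hc hK.isClosed hxK
  set u := (InnerProductSpace.toDual ℝ Plane).symm f with hu
  have hfu : ∀ y, f y = ⟪y, u⟫ := fun y => by
    rw [real_inner_comm, hu, InnerProductSpace.toDual_symm_apply]
  have h1 : supportFunction K u ≤ r := supportFunction_le h0 fun y hy => by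
    rw [← hfu]; exact (hf y hy).le
  have h2 := hx u
  rw [hfu] at hr
  linarith

/-- The circumscribed regular-fan polygons with `2 ^ (m + 2)` normals exhaust the body. -/
theorem iInter_fanPolygon {K : Set Plane} (hK : IsCompact K) (hc : Convex ℝ K)
    (h0 : K.Nonempty) :
    ⋂ m : ℕ, fanPolygon (regularFan (4 * 2 ^ m)) (supportFunction K) = K := by
  apply Subset.antisymm
  · intro x hx
    rw [mem_iInter] at hx
    refine mem_of_forall_inner_le hK hc h0 fun w => ?_
    obtain ⟨r, t, hr, ht, rfl⟩ := exists_eq_smul_unitVec w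
    rw [real_inner_smul_right, supportFunction_smul K hr]
    refine mul_le_mul_of_nonneg_left ?_ hr
    have hpi := Real.pi_pos
    have hlim : Filter.Tendsto (fun m : ℕ => ((4 * 2 ^ m : ℕ) : ℝ)) Filter.atTop Filter.atTop := by
      refine tendsto_natCast_atTop_atTop.comp ?_
      exact (tendsto_pow_atTop_atTop_of_one_lt one_lt_two).const_mul_atTop' (by norm_num)
    -- The angle `t` is approximated by multiples of the fan step; the constraints at these
    -- directions pass to the limit because the support function is continuous.
    have h1 := (tendsto_nat_floor_mul_div_atTop (R := ℝ) (a := t / (2 * Real.pi))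
      (by positivity)).comp hlim
    have h2 := h1.mul_const (2 * Real.pi)
    rw [div_mul_cancel₀ _ (by positivity)] at h2
    have hcont : Continuous unitVec := by
      unfold unitVec
      fun_prop
    have h3 := (hcont.tendsto t).comp h2
    refine le_of_tendsto_of_tendsto ((continuous_const.inner continuous_id).tendsto _ |>.comp h3)
      (((continuous_supportFunction hK h0).tendsto _).comp h3) (Filter.Eventually.of_forall ?_)
    intro m
    have := hx m ⌊t / (2 * Real.pi) * ((4 * 2 ^ m : ℕ) : ℝ)⌋₊
    simp only [regularFan] at this
    simp only [Function.comp_apply, id]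
    have e : ∀ y z : ℝ, y / z * (2 * Real.pi) = y * (2 * Real.pi / z) := fun y z => by ring
    rw [e]
    exact this
  · refine subset_iInter fun m x hx j => inner_le_supportFunction hK hx _

/-- Doubling the number of directions keeps the old ones, at the even indices. -/
theorem antitone_fanPolygon (H : Plane → ℝ) :
    Antitone fun m : ℕ => fanPolygon (regularFan (4 * 2 ^ m)) H := by
  refine antitone_nat_of_succ_le fun m x hx j => ?_
  have := hx (2 * j)
  have e : regularFan (4 * 2 ^ (m + 1)) (2 * j) = regularFan (4 * 2 ^ m) j := by
    simp only [regularFan]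
    congr 1
    push_cast
    rw [pow_succ]
    field_simp
  rwa [e] at this

theorem tendsto_volume_fanPolygon {K : Set Plane} (hK : IsCompact K) (hc : Convex ℝ K)
    (h0 : K.Nonempty) (hg : IsGauge (supportFunction K)) :
    Filter.Tendsto (fun m : ℕ => volume.real (fanPolygon (regularFan (4 * 2 ^ m))
      (supportFunction K))) Filter.atTop (nhds (volume.real K)) := by
  have hcomp : ∀ m : ℕ, IsCompact (fanPolygon (regularFan (4 * 2 ^ m)) (supportFunction K)) :=
    fun m => (isFan_regularFan (by positivity)).isCompact_fanPolygon hg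
  have := tendsto_measure_iInter_atTop (μ := volume)
    (fun m => (hcomp m).isClosed.measurableSet.nullMeasurableSet)
    (antitone_fanPolygon (supportFunction K)) ⟨0, (hcomp 0).measure_lt_top.ne⟩
  rw [iInter_fanPolygon hK hc h0] at this
  exact (ENNReal.tendsto_toReal hK.measure_lt_top.ne).comp this

/-! ### The area of `a K - b K` as a quadratic polynomial -/

theorem isCompact_smul_sub_smul {K : Set Plane} (hK : IsCompact K) (a b : ℝ) :
    IsCompact (a • K - b • K) := by
  rw [sub_eq_add_neg]
  exact (hK.smul a).add (hK.smul b).neg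

theorem supportFunction_smul_sub_smul {K : Set Plane} (hK : IsCompact K) (h0 : K.Nonempty)
    {a b : ℝ} (ha : 0 ≤ a) (hb : 0 ≤ b) (u : Plane) :
    supportFunction (a • K - b • K) u = a * supportFunction K u + b * supportFunction K (-u) := by
  have hcomp : IsCompact (a • K - b • K) := isCompact_smul_sub_smul hK a b
  apply le_antisymm
  · refine supportFunction_le (h0.smul_set.sub h0.smul_set) ?_
    rintro _ ⟨_, ⟨y, hy, rfl⟩, _, ⟨z, hz, rfl⟩, rfl⟩
    have h1 := mul_le_mul_of_nonneg_left (inner_le_supportFunction hK hy u) ha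
    have h2 := mul_le_mul_of_nonneg_left (inner_le_supportFunction hK hz (-u)) hb
    rw [inner_neg_right] at h2
    simp only [inner_sub_left, real_inner_smul_left]
    linarith
  · obtain ⟨y, hy, hyu⟩ := exists_inner_eq_supportFunction hK h0 u
    obtain ⟨z, hz, hzu⟩ := exists_inner_eq_supportFunction hK h0 (-u)
    have := inner_le_supportFunction hcomp
      (sub_mem_sub (smul_mem_smul_set (a := a) hy) (smul_mem_smul_set (a := b) hz)) u
    rw [inner_sub_left, real_inner_smul_left, real_inner_smul_left] at this
    rw [← hyu, ← hzu, inner_neg_right]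
    linarith

/-- For fixed normals the vertices depend linearly on the support values, so the sum of cross
products that gives the polygon's area is a quadratic form in `(a, b)`. -/
theorem fanVertex_combination (u : ℕ → Plane) (F G : Plane → ℝ) (a b : ℝ) (j : ℕ) :
    fanVertex u (fun w => a * F w + b * G w) j = a • fanVertex u F j + b • fanVertex u G j := by
  apply Plane.ext_coord <;> simp [fanVertex] <;> ring

theorem cross_combination (a b : ℝ) (v w v' w' : Plane) :
    cross (a • v + b • v') (a • w + b • w') =
      a ^ 2 * cross v w + b ^ 2 * cross v' w' + a * b * (cross v w' + cross v' w) := by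
  simp [cross]; ring

theorem isGauge_supportFunction {K : Set Plane} (hK : IsCompact K)
    (h0 : (0 : Plane) ∈ interior K) : IsGauge (supportFunction K) := by
  have hne : K.Nonempty := ⟨0, interior_subset h0⟩
  refine ⟨fun c hc u => supportFunction_smul K hc u, supportFunction_add_le hK hne, fun u hu => ?_⟩
  have hcont : Filter.Tendsto (fun ε : ℝ => ε • u) (nhdsWithin 0 (Ioi 0)) (nhds 0) := by
    have : Continuous fun ε : ℝ => ε • u := by fun_prop
    exact (this.tendsto' 0 0 (zero_smul _ _)).mono_left nhdsWithin_le_nhds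
  obtain ⟨ε, hε, hε0⟩ := ((hcont.eventually (mem_interior_iff_mem_nhds.1 h0)).and
    self_mem_nhdsWithin).exists
  have h1 := inner_le_supportFunction hK hε u
  rw [real_inner_smul_left] at h1
  exact lt_of_lt_of_le (mul_pos hε0 (real_inner_self_pos.2 hu)) h1

/-- The area of `a K - b K` is a quadratic polynomial. -/
theorem exists_mixed_area_of_zero_mem_interior {K : Set Plane} (hK : IsCompact K)
    (hc : Convex ℝ K) (h0 : (0 : Plane) ∈ interior K) :
    ∃ W : ℝ, ∀ a b : ℝ, 0 ≤ a → 0 ≤ b → volume.real (a • K - b • K) =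
      (a ^ 2 + b ^ 2) * volume.real K + a * b * W := by
  have hne : K.Nonempty := ⟨0, interior_subset h0⟩
  set H := supportFunction K with hH
  set G : Plane → ℝ := fun u => H (-u) with hG
  have hg := isGauge_supportFunction hK h0
  set A : ℝ → ℝ → ℕ → ℝ := fun a b m => volume.real (fanPolygon (regularFan (4 * 2 ^ m))
    fun u => a * H u + b * G u) with hA
  have hgab : ∀ a b : ℝ, 0 ≤ a → 0 ≤ b → 0 < a + b → IsGauge fun u => a * H u + b * G u := by
    intro a b ha hb hab
    refine ⟨fun c hc u => ?_, fun u v => ?_, fun u hu => ?_⟩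
    · simp only [hG, ← smul_neg, hH, hg.smul c hc]; ring
    · have h1 := mul_le_mul_of_nonneg_left (hg.add_le u v) ha
      have h2 := mul_le_mul_of_nonneg_left (hg.add_le (-u) (-v)) hb
      simp only [hG, neg_add]
      linarith
    · have h1 := hg.pos u hu
      have h2 := hg.pos (-u) (neg_ne_zero.2 hu)
      rcases ha.eq_or_lt with ha' | ha'
      · have : 0 < b := by linarith
        have := mul_pos this h2
        simp only [hG, ← ha']
        linarith
      · have := mul_pos ha' h1
        have := mul_nonneg hb h2.le
        simp only [hG]
        linarith
  have hsf : ∀ a b : ℝ, 0 ≤ a → 0 ≤ b →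
      supportFunction (a • K - b • K) = fun u => a * H u + b * G u := fun a b ha hb =>
    funext fun u => supportFunction_smul_sub_smul hK hne ha hb u
  have hlim : ∀ a b : ℝ, 0 ≤ a → 0 ≤ b → 0 < a + b →
      Filter.Tendsto (A a b) Filter.atTop (nhds (volume.real (a • K - b • K))) := by
    intro a b ha hb hab
    have h1 := hgab a b ha hb hab
    rw [← hsf a b ha hb] at h1
    have := tendsto_volume_fanPolygon (isCompact_smul_sub_smul hK a b) ((hc.smul a).sub (hc.smul b))
      (hne.smul_set.sub hne.smul_set) h1
    rwa [hsf a b ha hb] at this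
  -- The quadratic form is recovered from its values at `(1, 0)`, `(0, 1)` and `(1, 1)`; the
  -- identity then survives the limit in `m`.
  have hquad : ∀ a b : ℝ, 0 ≤ a → 0 ≤ b → 0 < a + b → ∀ m, A a b m =
      a ^ 2 * A 1 0 m + b ^ 2 * A 0 1 m + a * b * (A 1 1 m - A 1 0 m - A 0 1 m) := by
    intro a b ha hb hab m
    have hf := isFan_regularFan (k := 2 ^ m) (by positivity)
    simp only [hA]
    rw [hf.volume_fanPolygon (hgab a b ha hb hab),
      hf.volume_fanPolygon (hgab 1 0 (by simp) (by simp) (by simp)),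
      hf.volume_fanPolygon (hgab 0 1 (by simp) (by simp) (by simp)),
      hf.volume_fanPolygon (hgab 1 1 (by simp) (by simp) (by norm_num))]
    simp only [fanVertex_combination, cross_combination]
    rw [← Finset.sum_sub_distrib, ← Finset.sum_sub_distrib, Finset.mul_sum, Finset.mul_sum,
      Finset.mul_sum, ← Finset.sum_add_distrib, ← Finset.sum_add_distrib]
    exact Finset.sum_congr rfl fun j _ => by ring
  have z1 : (1 : ℝ) • K - (0 : ℝ) • K = K := by
    rw [one_smul, zero_smul_set hne, sub_zero]
  have z2 : (0 : ℝ) • K - (1 : ℝ) • K = -K := by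
    rw [one_smul, zero_smul_set hne, zero_sub]
  refine ⟨volume.real ((1 : ℝ) • K - (1 : ℝ) • K) - 2 * volume.real K, fun a b ha hb => ?_⟩
  -- At `a = b = 0` the support function vanishes and is no gauge, so this case is computed
  -- directly.
  rcases (add_nonneg ha hb).eq_or_lt with hab | hab
  · have ea : a = 0 := by linarith
    have eb : b = 0 := by linarith
    rw [ea, eb, zero_smul_set hne, sub_zero, ← singleton_zero, measureReal_def, measure_singleton]
    simp
  · have l1 := hlim 1 0 zero_le_one le_rfl (by norm_num)
    have l2 := hlim 0 1 le_rfl zero_le_one (by norm_num)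
    have l3 := hlim 1 1 zero_le_one zero_le_one (by norm_num)
    rw [z1] at l1
    rw [z2, measureReal_def, Measure.measure_neg, ← measureReal_def] at l2
    have l4 := ((l1.const_mul (a ^ 2)).add (l2.const_mul (b ^ 2))).add
      (((l3.sub l1).sub l2).const_mul (a * b))
    have l5 := hlim a b ha hb hab
    rw [funext (hquad a b ha hb hab)] at l5
    rw [tendsto_nhds_unique l5 l4]
    ring

theorem smul_vadd_sub_smul_vadd (K : Set Plane) (z : Plane) (a b : ℝ) :
    a • (z +ᵥ K) - b • (z +ᵥ K) = ((a - b) • z) +ᵥ (a • K - b • K) := by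
  ext x
  constructor
  · rintro ⟨_, ⟨_, ⟨y, hy, rfl⟩, rfl⟩, _, ⟨_, ⟨w, hw, rfl⟩, rfl⟩, rfl⟩
    refine ⟨a • y - b • w, sub_mem_sub (smul_mem_smul_set hy) (smul_mem_smul_set hw), ?_⟩
    simp only [vadd_eq_add]
    module
  · rintro ⟨_, ⟨_, ⟨y, hy, rfl⟩, _, ⟨w, hw, rfl⟩, rfl⟩, rfl⟩
    refine ⟨a • (z + y), smul_mem_smul_set ⟨y, hy, rfl⟩, b • (z + w),
      smul_mem_smul_set ⟨w, hw, rfl⟩, ?_⟩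
    simp only [vadd_eq_add]
    module

/-- Translating `K` only translates `a K - b K`, so an interior point may be moved to the origin. -/
theorem exists_mixed_area {K : Set Plane} (hK : IsCompact K)
    (hc : Convex ℝ K) (hi : (interior K).Nonempty) :
    ∃ W : ℝ, ∀ a b : ℝ, 0 ≤ a → 0 ≤ b → volume.real (a • K - b • K) =
      (a ^ 2 + b ^ 2) * volume.real K + a * b * W := by
  obtain ⟨z, hz⟩ := hi
  obtain ⟨W, hW⟩ := exists_mixed_area_of_zero_mem_interior (K := -z +ᵥ K) (hK.vadd _) (hc.vadd _)
    (by rw [interior_vadd]; exact ⟨z, hz, by simp⟩)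
  refine ⟨W, fun a b ha hb => ?_⟩
  have := hW a b ha hb
  simpa only [smul_vadd_sub_smul_vadd, measureReal_def, measure_vadd] using this

/-! ### Bounding the mixed area, and the staircase estimate -/

/-- A planar convex body satisfies `-K ⊆ 2 K + v`. -/
theorem exists_neg_subset {K : Set Plane} (hK : IsCompact K) (hc : Convex ℝ K)
    (hi : (interior K).Nonempty) : ∃ v : Plane, -K ⊆ v +ᵥ (2 : ℝ) • K := by
  have hne : K.Nonempty := hi.mono interior_subset
  let D : Plane × Plane × Plane → ℝ := fun z => cross (z.2.1 - z.1) (z.2.2 - z.1)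
  have hD : Continuous D := by
    simp only [D, cross, PiLp.sub_apply]
    fun_prop
  -- Take an inscribed triangle of maximal area.
  obtain ⟨⟨x, y, z⟩, ⟨hx, hy, hz⟩, hmax⟩ := (hK.prod (hK.prod hK)).exists_isMaxOn
    (hne.prod (hne.prod hne)) hD.continuousOn
  have hmax' : ∀ x' ∈ K, ∀ y' ∈ K, ∀ z' ∈ K, D (x', y', z') ≤ D (x, y, z) :=
    fun x' hx' y' hy' z' hz' => hmax (a := (x', y', z')) ⟨hx', hy', hz'⟩
  have hpos : 0 < D (x, y, z) := by
    obtain ⟨c, hc⟩ := hi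
    have key : ∀ w : Plane, ∀ᶠ ε in nhdsWithin (0 : ℝ) (Ioi 0), c + ε • w ∈ K := fun w => by
      have hcont : Continuous fun ε : ℝ => c + ε • w := by fun_prop
      exact ((hcont.tendsto' 0 c (by simp)).mono_left nhdsWithin_le_nhds).eventually
        (mem_interior_iff_mem_nhds.1 hc)
    obtain ⟨ε, ⟨h1, h2⟩, h3⟩ := (((key !₂[1, 0]).and (key !₂[0, 1])).and
      self_mem_nhdsWithin).exists
    have h3 : 0 < ε := h3
    refine lt_of_lt_of_le ?_ (hmax' _ (interior_subset hc) _ h1 _ h2)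
    simp [D, cross]
    positivity
  refine ⟨-(x + y + z), fun w hw => ?_⟩
  have hw : -w ∈ K := hw
  set M := D (x, y, z) with hM
  -- These are the barycentric coordinates of `-w` in the maximal triangle; maximality bounds each
  -- by `1`. So `(1 - l) / 2`, `(1 - m) / 2`, `(1 - r) / 2` are convex weights, and twice their
  -- combination is `w + x + y + z`.
  set l := D (-w, y, z) / M with hl
  set m := D (x, -w, z) / M with hm
  set r := D (x, y, -w) / M with hr
  have l1 : l ≤ 1 := (div_le_one hpos).2 (hmax' _ hw _ hy _ hz)
  have m1 : m ≤ 1 := (div_le_one hpos).2 (hmax' _ hx _ hw _ hz)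
  have r1 : r ≤ 1 := (div_le_one hpos).2 (hmax' _ hx _ hy _ hw)
  have hsum : l + m + r = 1 := by
    rw [hl, hm, hr, ← add_div, ← add_div, div_eq_one_iff_eq hpos.ne']
    simp [hM, D, cross]; ring
  have hbary : l • x + m • y + r • z = -w := by
    have h : M • (l • x + m • y + r • z) = M • (-w) := by
      simp only [smul_add, smul_smul, hl, hm, hr, mul_div_cancel₀ _ hpos.ne']
      apply Plane.ext_coord <;> simp [hM, D, cross] <;> ring
    exact smul_right_injective _ hpos.ne' h
  have hmem : ((1 - l) / 2) • x + ((1 - m) / 2) • y + ((1 - r) / 2) • z ∈ K := by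
    have := hc.sum_mem (t := Finset.univ) (w := ![(1 - l) / 2, (1 - m) / 2, (1 - r) / 2])
      (z := ![x, y, z]) (by intro i _; fin_cases i <;> simp <;> linarith)
      (by simp [Fin.sum_univ_three]; linarith) (by intro i _; fin_cases i <;> simpa)
    simpa [Fin.sum_univ_three] using this
  refine ⟨_, smul_mem_smul_set hmem, ?_⟩
  simp only [vadd_eq_add]
  rw [← neg_neg w, ← hbary]
  module

theorem smul_sub_smul_mono {K : Set Plane} (hc : Convex ℝ K) (h0 : (0 : Plane) ∈ K)
    {a a' b b' : ℝ} (ha : 0 ≤ a) (haa : a ≤ a') (hb : 0 ≤ b) (hbb : b ≤ b') :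
    a • K - b • K ⊆ a' • K - b' • K := by
  have key : ∀ {s t : ℝ}, 0 ≤ s → s ≤ t → s • K ⊆ t • K := by
    rintro s t hs hst _ ⟨x, hx, rfl⟩
    rcases (hs.trans hst).eq_or_lt with h | h
    · have : s = 0 := by linarith
      exact ⟨0, h0, by simp [this]⟩
    · refine ⟨(s / t) • x, hc.smul_mem_of_zero_mem h0 hx ⟨by positivity, (div_le_one h).2 hst⟩, ?_⟩
      simp only [smul_smul, mul_div_cancel₀ _ h.ne']
  exact sub_subset_sub (key ha haa) (key hb hbb)

/-- The mixed-area coefficient of `K` and `-K` is at most four times the area. -/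
theorem mixed_area_le {K : Set Plane} (hK : IsCompact K) (hc : Convex ℝ K)
    (hi : (interior K).Nonempty) {W : ℝ}
    (hW : ∀ a b : ℝ, 0 ≤ a → 0 ≤ b → volume.real (a • K - b • K) =
      (a ^ 2 + b ^ 2) * volume.real K + a * b * W) : W ≤ 4 * volume.real K := by
  obtain ⟨v, hv⟩ := exists_neg_subset hK hc hi
  set V := volume.real K with hV
  have hV0 : 0 ≤ V := measureReal_nonneg
  have key : ∀ ε : ℝ, 0 < ε → W ≤ 4 * V + 3 * ε * V := by
    intro ε hε
    -- Comparing areas gives `(1 + ε²) V + ε W ≤ (1 + 2 ε)² V`, and the terms of first order in `ε`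
    -- give the bound on `W`.
    have hsub : (1 : ℝ) • K - ε • K ⊆ (ε • v) +ᵥ ((1 + ε * 2) • K) := by
      rintro _ ⟨_, ⟨x, hx, rfl⟩, _, ⟨y, hy, rfl⟩, rfl⟩
      obtain ⟨_, ⟨z, hz, rfl⟩, hzy⟩ := hv (neg_mem_neg.2 hy)
      rw [hc.add_smul zero_le_one (by positivity)]
      refine ⟨_, add_mem_add (smul_mem_smul_set hx) (smul_mem_smul_set hz), ?_⟩
      simp only [vadd_eq_add] at hzy ⊢
      rw [sub_eq_add_neg, ← smul_neg, ← hzy]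
      module
    have hcomp : IsCompact ((ε • v) +ᵥ ((1 + ε * 2) • K)) := (hK.smul _).vadd _
    have h := measureReal_mono (μ := volume) hsub hcomp.measure_lt_top.ne
    rw [hW 1 ε zero_le_one hε.le, measureReal_def, measure_vadd, Measure.addHaar_smul,
      ENNReal.toReal_mul, ← measureReal_def, ← hV, finrank_euclideanSpace, Fintype.card_fin,
      ENNReal.toReal_ofReal (abs_nonneg _), abs_of_nonneg (by positivity)] at h
    have : ε * W ≤ ε * (4 * V + 3 * ε * V) := by linarith
    exact le_of_mul_le_mul_left this hε
  by_contra! hlt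
  -- This `ε` makes the error at most half of the supposed excess `W - 4 V`; the summand `1` keeps
  -- the denominator positive.
  have h1 := key ((W - 4 * V) / (3 * V + 1) / 2) (by
    have : 0 < W - 4 * V := by linarith
    positivity)
  have h2 : 3 * ((W - 4 * V) / (3 * V + 1) / 2) * V ≤ (W - 4 * V) / 2 := by
    have : (W - 4 * V) / (3 * V + 1) * (3 * V + 1) = W - 4 * V := div_mul_cancel₀ _ (by positivity)
    have h3 : 0 ≤ (W - 4 * V) / (3 * V + 1) := div_nonneg (by linarith) (by positivity)
    nlinarith
  linarith

/-- Inclusion–exclusion for a staircase of Minkowski sums. -/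
theorem volume_staircase_le {K : Set Plane} (hK : IsCompact K) (hc : Convex ℝ K)
    (h0 : (0 : Plane) ∈ K) {W : ℝ}
    (hW : ∀ a b : ℝ, 0 ≤ a → 0 ≤ b → volume.real (a • K - b • K) =
      (a ^ 2 + b ^ 2) * volume.real K + a * b * W) {α β : ℕ → ℝ} (hα : Monotone α)
    (hα0 : α 0 = 0) {n : ℕ} (hβ0 : ∀ j < n, 0 ≤ β j) (hβ : ∀ j, j + 1 < n → β (j + 1) ≤ β j)
    (m : ℕ) (hm : m < n) :
    volume.real (⋃ j ∈ Finset.range (m + 1), (α (j + 1) • K - β j • K)) ≤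
      (α (m + 1) ^ 2 + β 0 ^ 2) * volume.real K +
        W * ∑ j ∈ Finset.range (m + 1), β j * (α (j + 1) - α j) := by
  have hαn : ∀ j, 0 ≤ α j := fun j => hα0 ▸ hα (Nat.zero_le j)
  have hcomp : ∀ a b : ℝ, IsCompact (a • K - b • K) := isCompact_smul_sub_smul hK
  induction m with
  | zero =>
    simp only [zero_add, Finset.range_one, Finset.mem_singleton, iUnion_iUnion_eq_left,
      Finset.sum_singleton, hα0, hW _ _ (hαn 1) (hβ0 0 hm)]
    linarith
  | succ m ih =>
    have ih := ih (by omega)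
    have hUc : IsCompact (⋃ j ∈ Finset.range (m + 1), (α (j + 1) • K - β j • K)) :=
      (Finset.range (m + 1)).isCompact_biUnion fun j _ => hcomp _ _
    rw [Finset.range_add_one, Finset.set_biUnion_insert, union_comm, Finset.sum_insert (by simp)]
    have h1 := measureReal_union_add_inter (μ := volume)
      (s := ⋃ j ∈ Finset.range (m + 1), (α (j + 1) • K - β j • K))
      (t := α (m + 1 + 1) • K - β (m + 1) • K) (hcomp _ _).isClosed.measurableSet
      hUc.measure_lt_top.ne (hcomp _ _).measure_lt_top.ne
    -- The overlap contains the body of the inner corner. The new body exceeds it in area by `(α (m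
    -- + 2)² - α (m + 1)²) V + β (m + 1) (α (m + 2) - α (m + 1)) W`, so the squares telescope.
    have h2 : α (m + 1) • K - β (m + 1) • K ⊆
        (⋃ j ∈ Finset.range (m + 1), (α (j + 1) • K - β j • K)) ∩
          (α (m + 1 + 1) • K - β (m + 1) • K) := by
      refine subset_inter (Subset.trans ?_
        (subset_biUnion_of_mem (Finset.mem_coe.2 (Finset.self_mem_range_succ m)))) ?_
      · exact smul_sub_smul_mono hc h0 (hαn _) le_rfl (hβ0 _ hm) (hβ m hm)
      · exact smul_sub_smul_mono hc h0 (hαn _) (hα (Nat.le_succ _)) (hβ0 _ hm) le_rfl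
    have h3 := measureReal_mono (μ := volume) h2
      ((measure_mono inter_subset_right).trans_lt (hcomp _ _).measure_lt_top).ne
    rw [hW _ _ (hαn _) (hβ0 _ hm)] at h3 h1
    linarith

/-- Each point of the dual ball lies in one of `n` columns; monotonicity in both coefficients
replaces it by the right end of its column and the height over the left end. -/
theorem dualBallSum_subset_staircase {p : ℝ≥0∞} (hp : 1 ≤ p) {K : Set Plane} (hc : Convex ℝ K)
    (h0 : (0 : Plane) ∈ K) {n : ℕ} (hn : 0 < n) :
    dualBallSum p K ⊆ ⋃ j ∈ Finset.range n,
      ((((j + 1 : ℕ) : ℝ) / n) • K - (lpDualHeight p (j / n)) • K) := by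
  rintro x ⟨a, b, hab, hx⟩
  have hn' : (0 : ℝ) < n := Nat.cast_pos.2 hn
  have ha0 : 0 ≤ a := hab.1
  have ha1 := lpDualBall_fst_le_one hp hab
  -- The ceiling keeps `a = 1` in the last column; truncated subtraction puts `a = 0` in column `0`.
  set j := ⌈a * n⌉₊ - 1 with hj
  have hceil : ⌈a * n⌉₊ ≤ n := Nat.ceil_le.2 (by nlinarith)
  have hjn : j < n := by omega
  have h1 : a ≤ ((j + 1 : ℕ) : ℝ) / n := by
    rw [le_div_iff₀ hn']
    refine (Nat.le_ceil _).trans ?_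
    exact_mod_cast (by omega : ⌈a * n⌉₊ ≤ j + 1)
  have h2 : (j : ℝ) / n ≤ a := by
    rw [div_le_iff₀ hn']
    rcases Nat.eq_zero_or_pos ⌈a * n⌉₊ with h | h
    · have : j = 0 := by omega
      rw [this, Nat.cast_zero]
      positivity
    · have h3 := Nat.ceil_lt_add_one (a := a * n) (by positivity)
      have h4 : (j : ℝ) + 1 = ⌈a * n⌉₊ := by exact_mod_cast (by omega : j + 1 = ⌈a * n⌉₊)
      linarith
  have h3 : (0 : ℝ) ≤ j / n := by positivity
  refine mem_biUnion (Finset.mem_coe.2 (Finset.mem_range.2 hjn)) ?_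
  refine smul_sub_smul_mono hc h0 ha0 h1 hab.2.1 ?_ hx
  exact ((mem_lpDualBall_iff hp ha0 ha1).1 hab).2.trans
    (antitoneOn_lpDualHeight hp ⟨h3, h2.trans ha1⟩ ⟨ha0, ha1⟩ h2)

theorem volume_eq_zero_of_interior_empty {K : Set Plane} (hK : IsCompact K) (hc : Convex ℝ K)
    (hi : ¬ (interior K).Nonempty) : volume K = 0 := by
  rw [not_nonempty_iff_eq_empty] at hi
  have := hc.addHaar_frontier volume
  rwa [frontier, hi, sdiff_empty, hK.isClosed.closure_eq] at this

/-- A convex set through the origin with empty interior lies in a proper linear subspace, which then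
contains every `a K - b K`. -/
theorem volume_dualBallSum_eq_zero {p : ℝ≥0∞} {K : Set Plane} (hc : Convex ℝ K)
    (h0 : (0 : Plane) ∈ K) (hi : ¬ (interior K).Nonempty) : volume (dualBallSum p K) = 0 := by
  have hspan : Submodule.span ℝ K ≠ ⊤ := by
    intro h
    refine hi (hc.interior_nonempty_iff_affineSpan_eq_top.2 ?_)
    have := affineSpan_insert_zero (k := ℝ) K
    rw [insert_eq_of_mem h0, h] at this
    exact SetLike.coe_injective (by simpa using this)
  refine measure_mono_null ?_ (Measure.addHaar_submodule volume _ hspan)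
  rintro x ⟨a, b, _, _, ⟨y, hy, rfl⟩, _, ⟨z, hz, rfl⟩, rfl⟩
  exact Submodule.sub_mem _ (Submodule.smul_mem _ _ (Submodule.subset_span hy))
    (Submodule.smul_mem _ _ (Submodule.subset_span hz))

/-- The sharp upper bound for the area of the `p`-difference body. -/
theorem volume_dualBallSum_le {p : ℝ≥0∞} (hp : 1 ≤ p) {K : Set Plane} (hK : IsCompact K)
    (hc : Convex ℝ K) (h0 : (0 : Plane) ∈ K) :
    volume.real (dualBallSum p K) ≤ (2 + 4 * lpDualArea p) * volume.real K := by
  by_cases hi : (interior K).Nonempty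
  swap
  · rw [measureReal_def, measureReal_def, volume_dualBallSum_eq_zero hc h0 hi,
      volume_eq_zero_of_interior_empty hK hc hi]
    simp
  obtain ⟨W, hW⟩ := exists_mixed_area hK hc hi
  have hW4 := mixed_area_le hK hc hi hW
  set V := volume.real K with hV
  have hV0 : 0 ≤ V := measureReal_nonneg
  have key : ∀ n : ℕ, volume.real (dualBallSum p K) ≤
      (2 + 4 * lpDualArea p) * V + 4 * V * (1 / ((n : ℝ) + 1)) := by
    intro m
    set n := m + 1 with hn
    have hn' : (0 : ℝ) < n := Nat.cast_pos.2 (by omega)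
    have hmem : ∀ j : ℕ, j ≤ n → (j : ℝ) / n ∈ Icc (0 : ℝ) 1 := fun j hj =>
      ⟨by positivity, (div_le_one hn').2 (by exact_mod_cast hj)⟩
    have hβ0 : ∀ j < n, 0 ≤ lpDualHeight p ((j : ℝ) / n) := fun j hj =>
      lpDualHeight_nonneg hp (hmem j hj.le).1 (hmem j hj.le).2
    have h1 := volume_staircase_le hK hc h0 hW (α := fun j : ℕ => (j : ℝ) / n)
      (β := fun j : ℕ => lpDualHeight p (j / n)) (n := n) (fun i j hij => by
        have : (i : ℝ) ≤ j := by exact_mod_cast hij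
        simp only
        gcongr) (by simp) hβ0 (fun j hj =>
        antitoneOn_lpDualHeight hp (hmem j (by omega)) (hmem (j + 1) hj.le) (by
          gcongr; omega)) m (by omega)
    have hcomp : IsCompact (⋃ j ∈ Finset.range n,
        ((((j + 1 : ℕ) : ℝ) / n) • K - (lpDualHeight p (j / n)) • K)) :=
      (Finset.range n).isCompact_biUnion fun j _ => isCompact_smul_sub_smul hK _ _
    have h2 := measureReal_mono (μ := volume)
      (dualBallSum_subset_staircase hp hc h0 (n := n) (by omega)) hcomp.measure_lt_top.ne
    have h3 : ∑ j ∈ Finset.range n, lpDualHeight p ((j : ℝ) / n) *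
        (((j + 1 : ℕ) : ℝ) / n - (j : ℝ) / n) =
        (∑ j ∈ Finset.range n, lpDualHeight p (j / n)) / n := by
      rw [Finset.sum_div]
      refine Finset.sum_congr rfl fun j _ => ?_
      push_cast
      ring
    have h4 := sum_lpDualHeight_le hp (n := n) (by omega)
    have h5 : 0 ≤ (∑ j ∈ Finset.range n, lpDualHeight p (j / n)) / n :=
      div_nonneg (Finset.sum_nonneg fun j hj => hβ0 j (Finset.mem_range.1 hj)) hn'.le
    simp only [← hn, h3, div_self hn'.ne', Nat.cast_zero, zero_div, lpDualHeight_zero hp] at h1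
    -- The Riemann sum is nonnegative, so `W` may be replaced by `4 V`; its discretization error `1
    -- / n` costs `4 V / n`.
    have h6 := mul_le_mul_of_nonneg_right hW4 h5
    have h7 := mul_le_mul_of_nonneg_left h4 (by positivity : (0 : ℝ) ≤ 4 * V)
    have h8 : (n : ℝ) = m + 1 := by rw [hn]; push_cast; ring
    rw [← h8]
    linarith
  have hlim := (tendsto_one_div_add_atTop_nhds_zero_nat (𝕜 := ℝ)).const_mul (4 * V)
  have := ge_of_tendsto' (hlim.const_add ((2 + 4 * lpDualArea p) * V)) key
  simpa using this

/-! ### Triangles with a vertex at the origin -/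

theorem convex_originTriangle (v w : Plane) : Convex ℝ (originTriangle v w) := by
  rintro _ ⟨s, t, hs, ht, hst, rfl⟩ _ ⟨s', t', hs', ht', hst', rfl⟩ a b ha hb hab
  refine ⟨a * s + b * s', a * t + b * t', by positivity, by positivity, ?_, by module⟩
  nlinarith

theorem zero_mem_originTriangle (v w : Plane) : (0 : Plane) ∈ originTriangle v w :=
  ⟨0, 0, le_rfl, le_rfl, by norm_num, by simp⟩

theorem left_mem_originTriangle (v w : Plane) : v ∈ originTriangle v w :=
  ⟨1, 0, zero_le_one, le_rfl, by norm_num, by simp⟩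

theorem right_mem_originTriangle (v w : Plane) : w ∈ originTriangle v w :=
  ⟨0, 1, le_rfl, zero_le_one, by norm_num, by simp⟩

theorem convexHull_eq_originTriangle (v w : Plane) :
    convexHull ℝ {0, v, w} = originTriangle v w := by
  apply Subset.antisymm
  · refine convexHull_min ?_ (convex_originTriangle v w)
    rintro x (rfl | rfl | rfl)
    · exact zero_mem_originTriangle _ _
    · exact left_mem_originTriangle _ _
    · exact right_mem_originTriangle _ _
  · rintro _ ⟨s, t, hs, ht, hst, rfl⟩
    have h := (convex_convexHull ℝ {0, v, w}).sum_mem (t := Finset.univ)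
      (w := ![1 - s - t, s, t]) (z := ![0, v, w])
      (by intro i _; fin_cases i <;> simp <;> linarith)
      (by simp only [Fin.sum_univ_three, Matrix.cons_val]; ring) (by
        intro i _
        apply subset_convexHull
        fin_cases i <;> simp)
    simpa [Fin.sum_univ_three] using h

theorem IsTriangleWithVertexAtOrigin.exists_eq {T : ConvexBody Plane}
    (hT : IsTriangleWithVertexAtOrigin T) :
    ∃ v w : Plane, cross v w ≠ 0 ∧ (T : Set Plane) = originTriangle v w := by
  obtain ⟨S, ⟨i, hi⟩, hS⟩ := hT
  refine ⟨S.points (i + 1), S.points (i + 2), ?_, ?_⟩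
  · intro hcr
    have hind : ∀ s t : ℝ, s • S.points (i + 1) + t • S.points (i + 2) = 0 → s = 0 ∧ t = 0 := by
      intro s t hst
      have h := affineIndependent_iff.1 S.independent Finset.univ
        (fun j => if j = i then -(s + t) else if j = i + 1 then s else t)
        (by fin_cases i <;> simp [Fin.sum_univ_three]) (by
          fin_cases i
          · simp_all [Fin.sum_univ_three]
          · rw [← hst]; simp_all [Fin.sum_univ_three, add_comm]
          · simp_all [Fin.sum_univ_three])
      have h1 := h (i + 1) (Finset.mem_univ _)
      have h2 := h (i + 2) (Finset.mem_univ _)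
      fin_cases i <;> simp at h1 h2 <;> exact ⟨h1, h2⟩
    simp only [cross] at hcr
    -- A vanishing determinant gives one linear relation per coordinate; independence then makes
    -- both coordinates of the vertex `i + 1` zero.
    have h1 := hind (S.points (i + 2) 0) (-S.points (i + 1) 0) (by
      apply Plane.ext_coord <;> simp <;> linarith)
    have h2 := hind (S.points (i + 2) 1) (-S.points (i + 1) 1) (by
      apply Plane.ext_coord <;> simp <;> linarith)
    have hz : S.points (i + 1) = 0 :=
      Plane.ext_coord (by simpa using h1.2) (by simpa using h2.2)
    have := (hind 1 0 (by simp [hz])).1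
    norm_num at this
  · rw [hS, ← convexHull_eq_originTriangle]
    congr 1
    ext x
    simp only [mem_range, mem_insert_iff, mem_singleton_iff]
    rw [← hi]
    constructor
    · rintro ⟨j, rfl⟩
      have : j = i ∨ j = i + 1 ∨ j = i + 2 := by clear hi; revert i j; decide
      rcases this with h | h | h <;> simp [h]
    · rintro (rfl | rfl | rfl) <;> exact ⟨_, rfl⟩

/-- In the basis `v, w` the four open quadrants contain the interior of `T`, that of `-T`, and two
reflected copies of the region under the height function, since `a v - b w` and `a w - b v` belong
to `a T - b T`. -/
theorem volume_dualBallSum_originTriangle_ge {p : ℝ≥0∞} (hp : 1 ≤ p) {v w : Plane}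
    (hvw : cross v w ≠ 0) :
    (2 + 4 * lpDualArea p) * volume.real (originTriangle v w) ≤
      volume.real (dualBallSum p (originTriangle v w)) := by
  set T := originTriangle v w with hT
  set D := dualBallSum p T with hD
  have hDc : IsCompact D := isCompact_dualBallSum hp (isCompact_originTriangle v w)
  set R₁ : Set Plane := {x | x 0 ∈ Ioo (0 : ℝ) 1 ∧ 0 < x 1 ∧ x 1 < 1 - x 0} with hR₁
  set R₂ : Set Plane := {x | x 0 ∈ Ioo (0 : ℝ) 1 ∧ 0 < x 1 ∧ x 1 < lpDualHeight p (x 0)} with hR₂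
  have hI : 0 ≤ lpDualArea p := intervalIntegral.integral_nonneg zero_le_one fun x hx =>
    lpDualHeight_nonneg hp hx.1 hx.2
  have hvR₁ : volume.real R₁ = 1 / 2 := by
    rw [measureReal_def, hR₁, volume_standard_triangle_interior,
      ENNReal.toReal_ofReal (by norm_num)]
  have hvR₂ : volume.real R₂ = lpDualArea p := by
    rw [measureReal_def, hR₂, volume_coord_regionBetween (antitoneOn_lpDualHeight hp)
      fun x hx => lpDualHeight_nonneg hp hx.1 hx.2, ← lpDualArea, ENNReal.toReal_ofReal hI]
  have himage : ∀ (v w : Plane) (R : Set Plane),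
      volume.real (basisMap v w '' R) = |cross v w| * volume.real R := fun v w R => by
    rw [measureReal_def, volume_basisMap_image, ENNReal.toReal_mul,
      ENNReal.toReal_ofReal (abs_nonneg _), measureReal_def]
  -- The half-planes of positive `v`- and positive `w`-coordinate, for either orientation of the
  -- basis; they split the body into four disjoint pieces.
  set H : Set Plane := {x | 0 < cross x w * cross v w} with hH
  set H' : Set Plane := {x | 0 < cross v x * cross v w} with hH'
  have hHm : MeasurableSet H := by
    refine (isOpen_lt continuous_const ?_).measurableSet
    unfold cross
    fun_prop
  have hHm' : MeasurableSet H' := by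
    refine (isOpen_lt continuous_const ?_).measurableSet
    unfold cross
    fun_prop
  have hsq : 0 < cross v w * cross v w := mul_self_pos.2 hvw
  have hsub : ∀ s : Set Plane, s ⊆ D → volume s ≠ ∞ := fun s hs =>
    ((measure_mono hs).trans_lt hDc.measure_lt_top).ne
  have e1 := measureReal_inter_add_sdiff (μ := volume) (s := D) hHm (hsub D Subset.rfl)
  have e2 := measureReal_inter_add_sdiff (μ := volume) (s := D ∩ H) hHm'
    (hsub _ inter_subset_left)
  have e3 := measureReal_inter_add_sdiff (μ := volume) (s := D \ H) hHm'
    (hsub _ sdiff_subset)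
  have mH : ∀ s t : ℝ, s • v + t • w ∈ H ↔ 0 < s := fun s t => by
    have : cross (s • v + t • w) w * cross v w = s * (cross v w * cross v w) := by
      simp [cross]; ring
    rw [hH, mem_ofPred_eq, this, mul_pos_iff_of_pos_right hsq]
  have mH' : ∀ s t : ℝ, s • v + t • w ∈ H' ↔ 0 < t := fun s t => by
    have : cross v (s • v + t • w) * cross v w = t * (cross v w * cross v w) := by
      simp [cross]; ring
    rw [hH', mem_ofPred_eq, this, mul_pos_iff_of_pos_right hsq]
  have b1 : basisMap v w '' R₁ ⊆ D ∩ H ∩ H' := by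
    rintro _ ⟨x, ⟨⟨h0, h1⟩, h2, h3⟩, rfl⟩
    refine ⟨⟨⟨1, 0, one_zero_mem_lpDualBall hp, ?_⟩, ?_⟩, ?_⟩
    · rw [one_smul, zero_smul_set ⟨0, zero_mem_originTriangle v w⟩, sub_zero]
      exact ⟨x 0, x 1, h0.le, h2.le, by linarith, rfl⟩
    · exact (mH _ _).2 h0
    · exact (mH' _ _).2 h2
  have b2 : basisMap v (-w) '' R₂ ⊆ (D ∩ H) \ H' := by
    rintro _ ⟨x, ⟨⟨h0, h1⟩, h2, h3⟩, rfl⟩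
    have e : basisMap v (-w) x = x 0 • v + (-x 1) • w := by
      change x 0 • v + x 1 • (-w) = _
      module
    rw [e]
    refine ⟨⟨⟨x 0, x 1, (mem_lpDualBall_iff hp h0.le h1.le).2 ⟨h2.le, h3.le⟩, ?_⟩, ?_⟩, ?_⟩
    · exact ⟨_, smul_mem_smul_set (left_mem_originTriangle v w), _,
        smul_mem_smul_set (right_mem_originTriangle v w), by module⟩
    · exact (mH _ _).2 h0
    · rw [mH']; linarith
  have b3 : basisMap (-v) w '' R₂ ⊆ (D \ H) ∩ H' := by
    rintro _ ⟨x, ⟨⟨h0, h1⟩, h2, h3⟩, rfl⟩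
    have e : basisMap (-v) w x = (-x 0) • v + x 1 • w := by
      change x 0 • (-v) + x 1 • w = _
      module
    rw [e]
    refine ⟨⟨⟨x 1, x 0, lpDualBall_swap ((mem_lpDualBall_iff hp h0.le h1.le).2
      ⟨h2.le, h3.le⟩), ?_⟩, ?_⟩, ?_⟩
    · exact ⟨_, smul_mem_smul_set (right_mem_originTriangle v w), _,
        smul_mem_smul_set (left_mem_originTriangle v w), by module⟩
    · rw [mH]; linarith
    · exact (mH' _ _).2 h2
  have b4 : basisMap (-v) (-w) '' R₁ ⊆ (D \ H) \ H' := by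
    rintro _ ⟨x, ⟨⟨h0, h1⟩, h2, h3⟩, rfl⟩
    have e : basisMap (-v) (-w) x = (-x 0) • v + (-x 1) • w := by
      change x 0 • (-v) + x 1 • (-w) = _
      module
    rw [e]
    refine ⟨⟨⟨0, 1, lpDualBall_swap (one_zero_mem_lpDualBall hp), ?_⟩, ?_⟩, ?_⟩
    · rw [one_smul, zero_smul_set ⟨0, zero_mem_originTriangle v w⟩, zero_sub]
      exact ⟨x 0, x 1, h0.le, h2.le, by linarith, by module⟩
    · rw [mH]; linarith
    · rw [mH']; linarith
  have m1 := measureReal_mono b1 (hsub _ (inter_subset_left.trans inter_subset_left))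
  have m2 := measureReal_mono b2 (hsub _ (sdiff_subset.trans inter_subset_left))
  have m3 := measureReal_mono b3 (hsub _ (inter_subset_left.trans sdiff_subset))
  have m4 := measureReal_mono b4 (hsub _ (sdiff_subset.trans sdiff_subset))
  have c2 : |cross v (-w)| = |cross v w| := by rw [← abs_neg]; congr 1; simp [cross]; ring
  have c3 : |cross (-v) w| = |cross v w| := by rw [← abs_neg]; congr 1; simp [cross]; ring
  have c4 : |cross (-v) (-w)| = |cross v w| := by congr 1; simp [cross]
  rw [himage, hvR₁] at m1
  rw [himage, hvR₂, c2] at m2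
  rw [himage, hvR₂, c3] at m3
  rw [himage, hvR₁, c4] at m4
  rw [hT, volume_originTriangle]
  linarith

/-! ### The area of the dual ball as an integral -/

/-- First coordinate of the boundary point of the dual ball with normal `(cos t, sin t)`. -/
noncomputable def dualCos (q t : ℝ) : ℝ :=
  Real.cos t ^ (q - 1) / (Real.cos t ^ q + Real.sin t ^ q) ^ ((q - 1) / q)

/-- Second coordinate of the boundary point of the dual ball with normal `(cos t, sin t)`. -/
noncomputable def dualSin (q t : ℝ) : ℝ :=
  Real.sin t ^ (q - 1) / (Real.cos t ^ q + Real.sin t ^ q) ^ ((q - 1) / q)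

theorem dualSin_eq (q t : ℝ) : dualSin q t = dualCos q (Real.pi / 2 - t) := by
  rw [dualSin, dualCos, Real.cos_pi_div_two_sub, Real.sin_pi_div_two_sub, add_comm]

section

variable {q t : ℝ}

theorem cos_pos_of_mem (ht : t ∈ Ioo 0 (Real.pi / 2)) : 0 < Real.cos t :=
  Real.cos_pos_of_mem_Ioo ⟨by linarith [ht.1, Real.pi_pos], ht.2⟩

theorem sin_pos_of_mem (ht : t ∈ Ioo 0 (Real.pi / 2)) : 0 < Real.sin t :=
  Real.sin_pos_of_pos_of_lt_pi ht.1 (by linarith [ht.2, Real.pi_pos])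

/-- The point is extremal in the direction `(cos t, sin t)`. A higher point above the same abscissa
would exceed the support value, as `sin t > 0`. -/
theorem lpDualHeight_dualCos (hq : 1 < q) (ht : t ∈ Ioo 0 (Real.pi / 2)) :
    lpDualHeight (ENNReal.ofReal q) (dualCos q t) = dualSin q t := by
  have hp : 1 ≤ ENNReal.ofReal q := by simpa using ENNReal.ofReal_le_ofReal hq.le
  have hc := cos_pos_of_mem ht
  have hs := sin_pos_of_mem ht
  have hpos : 0 < Real.cos t ^ q + Real.sin t ^ q := by positivity
  have hm := rpow_div_mem_lpDualBall hq hc.le hs.le hpos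
  have hi := rpow_div_inner hq hc.le hs.le hpos
  rw [← dualCos, ← dualSin] at hm hi
  have h0 := hm.1
  have h1 := lpDualBall_fst_le_one hp hm
  refine le_antisymm ?_ ((mem_lpDualBall_iff hp h0 h1).1 hm).2
  have h2 := (lpDualHeight_mem hp h0 h1).2.2 _ _ hc.le hs.le
  rw [← hi] at h2
  simp only [add_le_add_iff_left] at h2
  exact le_of_mul_le_mul_right h2 hs

/-- The integrand in the formula for the constant. -/
noncomputable def dualIntegrand (q t : ℝ) : ℝ :=
  Real.sin t ^ (q - 2) * Real.cos t ^ (q - 2) /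
    (Real.sin t ^ q + Real.cos t ^ q) ^ (2 * ((q - 1) / q))

theorem hasDerivAt_dualCos (hq : 1 < q) (ht : t ∈ Ioo 0 (Real.pi / 2)) :
    HasDerivAt (dualCos q) (-((q - 1) * dualIntegrand q t * Real.sin t *
      (Real.sin t ^ q + Real.cos t ^ q) ^ (-(1 / q)))) t := by
  have hc := cos_pos_of_mem ht
  have hs := sin_pos_of_mem ht
  have hq0 : 0 < q := by linarith
  have hpos : 0 < Real.sin t ^ q + Real.cos t ^ q := by positivity
  have hN : HasDerivAt (fun t => Real.cos t ^ q + Real.sin t ^ q)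
      (-Real.sin t * q * Real.cos t ^ (q - 1) + Real.cos t * q * Real.sin t ^ (q - 1)) t :=
    ((Real.hasDerivAt_cos t).rpow_const (Or.inl hc.ne')).add
      ((Real.hasDerivAt_sin t).rpow_const (Or.inl hs.ne'))
  have h1 := (Real.hasDerivAt_cos t).rpow_const (p := q - 1) (Or.inl hc.ne')
  have hpos' : Real.cos t ^ q + Real.sin t ^ q ≠ 0 := by rw [add_comm]; exact hpos.ne'
  have h2 := hN.rpow_const (p := -((q - 1) / q)) (Or.inl hpos')
  have h3 := h1.mul h2
  have hf : dualCos q =ᶠ[nhds t] fun t => Real.cos t ^ (q - 1) *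
      (Real.cos t ^ q + Real.sin t ^ q) ^ (-((q - 1) / q)) := by
    filter_upwards [isOpen_Ioo.mem_nhds ht] with x hx
    have := cos_pos_of_mem hx
    have := sin_pos_of_mem hx
    rw [dualCos, Real.rpow_neg (by positivity), div_eq_mul_inv]
  refine (h3.congr_of_eventuallyEq hf).congr_deriv ?_
  rw [dualIntegrand, add_comm (Real.cos t ^ q)]
  set S := Real.sin t ^ q + Real.cos t ^ q with hS
  set c := Real.cos t with hcdef
  set s := Real.sin t with hsdef
  have hsc : s ^ 2 + c ^ 2 = 1 := Real.sin_sq_add_cos_sq t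
  have p1 : c ^ (q - 1) = c ^ (q - 2) * c := by
    nth_rewrite 3 [← Real.rpow_one c]
    rw [← Real.rpow_add hc]; congr 1; ring
  have p2 : c ^ (q - 1 - 1) = c ^ (q - 2) := by congr 1; ring
  have p3 : s ^ (q - 1) = s ^ (q - 2) * s := by
    nth_rewrite 3 [← Real.rpow_one s]
    rw [← Real.rpow_add hs]; congr 1; ring
  have p4 : c ^ q = c ^ (q - 2) * c ^ 2 := by
    rw [← Real.rpow_natCast c 2, ← Real.rpow_add hc]; congr 1; push_cast; ring
  have p5 : s ^ q = s ^ (q - 2) * s ^ 2 := by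
    rw [← Real.rpow_natCast s 2, ← Real.rpow_add hs]; congr 1; push_cast; ring
  have e1 : S ^ (-((q - 1) / q)) = S ^ (-((q - 1) / q) - 1) * S := by
    nth_rewrite 3 [← Real.rpow_one S]
    rw [← Real.rpow_add hpos]; congr 1; ring
  have e2 : s ^ (q - 2) * c ^ (q - 2) / S ^ (2 * ((q - 1) / q)) =
      s ^ (q - 2) * c ^ (q - 2) * S ^ (-(2 * ((q - 1) / q))) := by
    rw [Real.rpow_neg hpos.le, div_eq_mul_inv]
  have e3 : S ^ (-(2 * ((q - 1) / q))) * S ^ (-(1 / q)) = S ^ (-((q - 1) / q) - 1) := by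
    rw [← Real.rpow_add hpos]; congr 1; field_simp; ring
  have e4 : -((q - 1) / q) * q = -(q - 1) := by field_simp
  rw [e2, e1, p1, p2, p3]
  rw [show -((q - 1) * (s ^ (q - 2) * c ^ (q - 2) * S ^ (-(2 * ((q - 1) / q)))) * s *
    S ^ (-(1 / q))) =
    -((q - 1) * (s ^ (q - 2) * c ^ (q - 2)) * s *
      (S ^ (-(2 * ((q - 1) / q))) * S ^ (-(1 / q)))) by ring, e3]
  have hS' : S = s ^ (q - 2) * s ^ 2 + c ^ (q - 2) * c ^ 2 := by rw [hS, p4, p5]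
  generalize S ^ (-((q - 1) / q) - 1) = X
  rw [show (-s * q * (c ^ (q - 2) * c) + c * q * (s ^ (q - 2) * s)) * -((q - 1) / q) * X =
    (-s * (c ^ (q - 2) * c) + c * (s ^ (q - 2) * s)) * (-((q - 1) / q) * q) * X by ring, e4, hS']
  -- After factoring out the lowest powers, the two sides differ only by `sin² + cos² = 1`.
  linear_combination (-(q - 1) * s * X * c ^ (q - 2) * s ^ (q - 2)) * hsc

theorem continuousOn_dualCos (hq : 1 < q) : ContinuousOn (dualCos q) (Icc 0 (Real.pi / 2)) := by
  have hpos : ∀ x ∈ Icc 0 (Real.pi / 2), Real.cos x ^ q + Real.sin x ^ q ≠ 0 := fun x hx => by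
    have hc := Real.cos_nonneg_of_mem_Icc ⟨by linarith [hx.1, Real.pi_pos], hx.2⟩
    have hs := Real.sin_nonneg_of_nonneg_of_le_pi hx.1 (by linarith [hx.2, Real.pi_pos])
    have h := Real.sin_sq_add_cos_sq x
    rcases hc.eq_or_lt with hc | hc
    · have : 0 < Real.sin x := lt_of_le_of_ne hs fun h' => by rw [← h', ← hc] at h; norm_num at h
      positivity
    · positivity
  unfold dualCos
  refine ContinuousOn.div ?_ ?_ fun x hx h => hpos x hx ?_
  · exact Real.continuous_cos.continuousOn.rpow_const fun x _ => Or.inr (by linarith)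
  · refine ContinuousOn.rpow_const ?_ fun x hx => Or.inl (hpos x hx)
    exact (Real.continuous_cos.continuousOn.rpow_const fun x _ => Or.inr (by linarith)).add
      (Real.continuous_sin.continuousOn.rpow_const fun x _ => Or.inr (by linarith))
  · have hc := Real.cos_nonneg_of_mem_Icc ⟨by linarith [hx.1, Real.pi_pos], hx.2⟩
    have hs := Real.sin_nonneg_of_nonneg_of_le_pi hx.1 (by linarith [hx.2, Real.pi_pos])
    exact ((Real.rpow_eq_zero_iff_of_nonneg (by positivity)).1 h).1

theorem dualIntegrand_pos (ht : t ∈ Ioo 0 (Real.pi / 2)) : 0 < dualIntegrand q t := by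
  have hc := cos_pos_of_mem ht
  have hs := sin_pos_of_mem ht
  unfold dualIntegrand
  positivity

theorem neg_deriv_dualCos_pos (hq : 1 < q) (ht : t ∈ Ioo 0 (Real.pi / 2)) :
    0 < (q - 1) * dualIntegrand q t * Real.sin t *
      (Real.sin t ^ q + Real.cos t ^ q) ^ (-(1 / q)) := by
  have hc := cos_pos_of_mem ht
  have hs := sin_pos_of_mem ht
  have := dualIntegrand_pos (q := q) ht
  have : 0 < q - 1 := by linarith
  positivity

theorem strictAntiOn_dualCos (hq : 1 < q) : StrictAntiOn (dualCos q) (Icc 0 (Real.pi / 2)) := by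
  refine strictAntiOn_of_deriv_neg (convex_Icc _ _) (continuousOn_dualCos hq) fun x hx => ?_
  rw [interior_Icc] at hx
  rw [(hasDerivAt_dualCos hq hx).deriv, neg_lt_zero]
  exact neg_deriv_dualCos_pos hq hx

theorem dualCos_image (hq : 1 < q) : dualCos q '' Ioo 0 (Real.pi / 2) = Ioo 0 1 := by
  have hpi : (0 : ℝ) ≤ Real.pi / 2 := by positivity
  have hq0 : q ≠ 0 := by linarith
  have hq1 : q - 1 ≠ 0 := by linarith
  have h0 : dualCos q 0 = 1 := by simp [dualCos, Real.zero_rpow hq0]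
  have h1 : dualCos q (Real.pi / 2) = 0 := by simp [dualCos, Real.zero_rpow hq1]
  apply Subset.antisymm
  · rintro _ ⟨x, hx, rfl⟩
    have hx' := Ioo_subset_Icc_self hx
    exact ⟨h1 ▸ strictAntiOn_dualCos hq hx' (right_mem_Icc.2 hpi) hx.2,
      h0 ▸ strictAntiOn_dualCos hq (left_mem_Icc.2 hpi) hx' hx.1⟩
  · have := intermediate_value_Ioo' hpi (continuousOn_dualCos hq)
    rwa [h0, h1] at this

/-- The area element of the dual ball in the variable `t`. -/
noncomputable def dualAreaElement (q t : ℝ) : ℝ :=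
  (q - 1) * dualIntegrand q t * Real.sin t *
    (Real.sin t ^ q + Real.cos t ^ q) ^ (-(1 / q)) * dualSin q t

/-- The reflection `t ↦ π / 2 - t` exchanges the two coordinates. In the sum, `cos t * dualCos q t +
sin t * dualSin q t` equals the `q`-norm of `(cos t, sin t)` and cancels the factor with exponent
`-(1 / q)`. -/
theorem dualAreaElement_add (hq : 1 < q) (ht : t ∈ Ioo 0 (Real.pi / 2)) :
    dualAreaElement q t + dualAreaElement q (Real.pi / 2 - t) = (q - 1) * dualIntegrand q t := by
  have hc := cos_pos_of_mem ht
  have hs := sin_pos_of_mem ht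
  have hpos : 0 < Real.cos t ^ q + Real.sin t ^ q := by positivity
  have hi := rpow_div_inner hq hc.le hs.le hpos
  rw [← dualCos, ← dualSin, lpAdd, if_neg ENNReal.ofReal_ne_top,
    ENNReal.toReal_ofReal (by linarith)] at hi
  have hsymm : dualIntegrand q (Real.pi / 2 - t) = dualIntegrand q t := by
    simp only [dualIntegrand, Real.sin_pi_div_two_sub, Real.cos_pi_div_two_sub]
    rw [mul_comm, add_comm]
  have e : dualSin q (Real.pi / 2 - t) = dualCos q t := by rw [dualSin_eq, sub_sub_cancel]
  simp only [dualAreaElement, hsymm, e, Real.sin_pi_div_two_sub, Real.cos_pi_div_two_sub]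
  rw [add_comm (Real.sin t ^ q)]
  have h1 : (Real.cos t ^ q + Real.sin t ^ q) ^ (-(1 / q)) *
      (Real.cos t ^ q + Real.sin t ^ q) ^ (1 / q) = 1 := by
    rw [← Real.rpow_add hpos, neg_add_cancel, Real.rpow_zero]
  rw [← hi] at h1
  linear_combination (q - 1) * dualIntegrand q t * h1

/-- Substitution of the abscissa `dualCos q t`, a bijection onto `(0, 1)`. Integrability is carried
over from the bounded monotone height, which settles convergence even where the integrand is
singular at the endpoints. -/
theorem dualAreaElement_integral (hq : 1 < q) :
    IntervalIntegrable (dualAreaElement q) volume 0 (Real.pi / 2) ∧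
      ∫ t in (0 : ℝ)..(Real.pi / 2), dualAreaElement q t = lpDualArea (ENNReal.ofReal q) := by
  have hp : 1 ≤ ENNReal.ofReal q := by simpa using ENNReal.ofReal_le_ofReal hq.le
  have hpi : (0 : ℝ) ≤ Real.pi / 2 := by positivity
  have hder : ∀ x ∈ Ioo 0 (Real.pi / 2), HasDerivWithinAt (dualCos q)
      (-((q - 1) * dualIntegrand q x * Real.sin x *
      (Real.sin x ^ q + Real.cos x ^ q) ^ (-(1 / q)))) (Ioo 0 (Real.pi / 2)) x :=
    fun x hx => (hasDerivAt_dualCos hq hx).hasDerivWithinAt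
  have hinj : InjOn (dualCos q) (Ioo 0 (Real.pi / 2)) :=
    (strictAntiOn_dualCos hq).injOn.mono Ioo_subset_Icc_self
  have heq : ∀ x ∈ Ioo 0 (Real.pi / 2), |-((q - 1) * dualIntegrand q x * Real.sin x *
      (Real.sin x ^ q + Real.cos x ^ q) ^ (-(1 / q)))| •
        lpDualHeight (ENNReal.ofReal q) (dualCos q x) = dualAreaElement q x := by
    intro x hx
    rw [abs_neg, abs_of_pos (neg_deriv_dualCos_pos hq hx), lpDualHeight_dualCos hq hx, smul_eq_mul,
      dualAreaElement]
  have h1 := integrableOn_image_iff_integrableOn_abs_deriv_smul measurableSet_Ioo hder hinj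
    (lpDualHeight (ENNReal.ofReal q))
  have h2 := integral_image_eq_integral_abs_deriv_smul measurableSet_Ioo hder hinj
    (lpDualHeight (ENNReal.ofReal q))
  rw [dualCos_image hq, integrableOn_congr_fun heq measurableSet_Ioo] at h1
  rw [dualCos_image hq, setIntegral_congr_fun measurableSet_Ioo heq] at h2
  have hint : IntegrableOn (lpDualHeight (ENNReal.ofReal q)) (Ioo 0 1) :=
    ((antitoneOn_lpDualHeight hp).integrableOn_isCompact isCompact_Icc).mono_set Ioo_subset_Icc_self
  refine ⟨(intervalIntegrable_iff_integrableOn_Ioo_of_le hpi).2 (h1.1 hint), ?_⟩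
  rw [lpDualArea, intervalIntegral.integral_of_le hpi, intervalIntegral.integral_of_le zero_le_one,
    integral_Ioc_eq_integral_Ioo, integral_Ioc_eq_integral_Ioo, h2]

/-- The area element and its reflection both integrate to the area of the dual ball, whence the
factor `2`. -/
theorem dualIntegrand_integral (hq : 1 < q) :
    IntervalIntegrable (dualIntegrand q) volume 0 (Real.pi / 2) ∧
      (q - 1) * ∫ t in (0 : ℝ)..(Real.pi / 2), dualIntegrand q t =
        2 * lpDualArea (ENNReal.ofReal q) := by
  have hpi : (0 : ℝ) ≤ Real.pi / 2 := by positivity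
  have hq1 : q - 1 ≠ 0 := by linarith
  obtain ⟨h1, h2⟩ := dualAreaElement_integral hq
  have h3 : IntervalIntegrable (fun t => dualAreaElement q (Real.pi / 2 - t)) volume 0
      (Real.pi / 2) := by
    simpa using (h1.comp_sub_left (Real.pi / 2)).symm
  have h4 : ∫ t in (0 : ℝ)..(Real.pi / 2), dualAreaElement q (Real.pi / 2 - t) =
      lpDualArea (ENNReal.ofReal q) := by
    rw [intervalIntegral.integral_comp_sub_left, sub_self, sub_zero, h2]
  have hsum := h1.add h3
  have heq : ∀ x ∈ Ioo 0 (Real.pi / 2), dualAreaElement q x + dualAreaElement q (Real.pi / 2 - x) =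
      (q - 1) * dualIntegrand q x := fun x hx => dualAreaElement_add hq hx
  have hI := intervalIntegral.integral_add h1 h3
  rw [h2, h4, intervalIntegral.integral_of_le hpi, integral_Ioc_eq_integral_Ioo,
    setIntegral_congr_fun measurableSet_Ioo heq, ← integral_Ioc_eq_integral_Ioo,
    ← intervalIntegral.integral_of_le hpi, intervalIntegral.integral_const_mul] at hI
  refine ⟨?_, by rw [hI]; ring⟩
  rw [intervalIntegrable_iff_integrableOn_Ioo_of_le hpi] at hsum ⊢
  have h5 : IntegrableOn (fun x => (q - 1) * dualIntegrand q x) (Ioo 0 (Real.pi / 2)) :=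
    hsum.congr_fun heq measurableSet_Ioo
  exact IntegrableOn.congr_fun (h5.const_mul (q - 1)⁻¹) (fun x _ => inv_mul_cancel_left₀ hq1 _)
    measurableSet_Ioo

end

/-! ### The sharp constant -/

theorem volume_pDifferenceBody_le {p : ℝ≥0∞} (hp : 1 ≤ p) {K : ConvexBody Plane}
    (h0 : (0 : Plane) ∈ K) : volume.real (pDifferenceBody p (K : Set Plane)) ≤
      (2 + 4 * lpDualArea p) * volume.real (K : Set Plane) := by
  rw [pDifferenceBody_eq_dualBallSum hp K.isCompact K.convex h0]
  exact volume_dualBallSum_le hp K.isCompact K.convex h0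

theorem volume_pDifferenceBody_originTriangle {p : ℝ≥0∞} (hp : 1 ≤ p) {T : ConvexBody Plane}
    {v w : Plane} (hvw : cross v w ≠ 0) (hT : (T : Set Plane) = originTriangle v w) :
    volume.real (pDifferenceBody p (T : Set Plane)) =
      (2 + 4 * lpDualArea p) * volume.real (T : Set Plane) := by
  have h0 : (0 : Plane) ∈ (T : Set Plane) := hT ▸ zero_mem_originTriangle v w
  refine le_antisymm (volume_pDifferenceBody_le hp h0) ?_
  rw [pDifferenceBody_eq_dualBallSum hp T.isCompact T.convex h0, hT]
  exact volume_dualBallSum_originTriangle_ge hp hvw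

theorem theorem1 (p : ℝ≥0∞) (hp : 1 ≤ p) :
    ∃ c : ℝ,
      IsLeast {C : ℝ | ∀ K : ConvexBody Plane, (0 : Plane) ∈ K →
        volume.real (pDifferenceBody p (K : Set Plane)) ≤ C * volume.real (K : Set Plane)} c ∧
      (∀ T : ConvexBody Plane, IsTriangleWithVertexAtOrigin T →
        volume.real (pDifferenceBody p (T : Set Plane)) = c * volume.real (T : Set Plane) ∧
        T ∈ bodiesAtOrigin ∧ IsMaxOn (differenceRatio p) bodiesAtOrigin T) ∧
      (∀ q : ℝ, 1 < q → p = ENNReal.ofReal q →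
        IntervalIntegrable (fun t : ℝ => Real.sin t ^ (q - 2) * Real.cos t ^ (q - 2) /
          (Real.sin t ^ q + Real.cos t ^ q) ^ (2 * ((q - 1) / q))) volume 0 (Real.pi / 2) ∧
        c = 2 * (1 + (q - 1) * ∫ t in (0 : ℝ)..(Real.pi / 2),
          Real.sin t ^ (q - 2) * Real.cos t ^ (q - 2) /
            (Real.sin t ^ q + Real.cos t ^ q) ^ (2 * ((q - 1) / q)))) := by
  have hpos : ∀ {T : ConvexBody Plane} {v w : Plane}, cross v w ≠ 0 →
      (T : Set Plane) = originTriangle v w → 0 < volume.real (T : Set Plane) := by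
    intro T v w hvw hT
    rw [hT, volume_originTriangle]
    positivity
  refine ⟨2 + 4 * lpDualArea p, ⟨fun K hK => volume_pDifferenceBody_le hp hK, fun C hC => ?_⟩,
    fun T hT => ?_, ?_⟩
  -- A single triangle with equality and positive area shows that no smaller constant works.
  · let T : ConvexBody Plane := ⟨originTriangle !₂[1, 0] !₂[0, 1], convex_originTriangle _ _,
      isCompact_originTriangle _ _, ⟨0, zero_mem_originTriangle _ _⟩⟩
    have hvw : cross !₂[1, 0] !₂[0, 1] ≠ 0 := by simp [cross]
    have h := hC T (zero_mem_originTriangle _ _)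
    rw [volume_pDifferenceBody_originTriangle (T := T) hp hvw rfl] at h
    exact le_of_mul_le_mul_right h (hpos (T := T) hvw rfl)
  · obtain ⟨v, w, hvw, hTe⟩ := hT.exists_eq
    have hvol := volume_pDifferenceBody_originTriangle hp hvw hTe
    have hTpos := hpos hvw hTe
    have h0 : (0 : Plane) ∈ (T : Set Plane) := hTe ▸ zero_mem_originTriangle v w
    refine ⟨hvol, ⟨h0, ?_⟩, fun K hK => ?_⟩
    · by_contra hi
      rw [measureReal_def, volume_eq_zero_of_interior_empty T.isCompact T.convex hi] at hTpos
      simp at hTpos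
    · change differenceRatio p K ≤ differenceRatio p T
      rw [differenceRatio, differenceRatio, hvol, mul_div_cancel_right₀ _ hTpos.ne']
      refine div_le_of_le_mul₀ measureReal_nonneg ?_ (volume_pDifferenceBody_le hp hK.1)
      have : 0 ≤ lpDualArea p := intervalIntegral.integral_nonneg zero_le_one fun x hx =>
        lpDualHeight_nonneg hp hx.1 hx.2
      positivity
  · rintro q hq rfl
    obtain ⟨h1, h2⟩ := dualIntegrand_integral hq
    refine ⟨h1, ?_⟩
    change _ = 2 * (1 + (q - 1) * ∫ t in (0 : ℝ)..(Real.pi / 2), dualIntegrand q t)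
    rw [h2]
    ring
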